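/- **Setting.** Let $\mathcal X\subseteq\mathbb R^p$ be convex and let $f:\operatorname{int}\mathcal X\to\mathbb R$ (extended by $+\infty$) be a $\nu_f$-self-concordant barrier of $\mathcal X$, $\nu_f\ge 1$: $f$ is convex and $C^3$ on $\operatorname{dom} f=\operatorname{int}\mathcal X$, $|\langle\nabla^3f(x)[u]u,u\rangle|\le 2\langle\nabla^2f(x)u,u\rangle^{3/2}$, $f(x)\to+\infty$ as $x$ approaches $\partial\mathcal X$, and $\sup_u\{2\langle\nabla f(x),u\rangle-\langle\nabla^2 f(x)u,u\rangle\}\le\nu_f$ for all $x\in\operatorname{dom} f$. Assume $\nabla^2f(x)\succ0$ on $\operatorname{dom} f$ and write $\|u\|_x=\langle\nabla^2f(x)u,u\rangle^{1/2}$, $\|v\|_x^*=\langle\nabla^2f(x)^{-1}v,v\rangle^{1/2}$. Let $g:\mathbb R^p\to\mathbb R\cup\{+\infty\}$ be proper, closed and convex, and let $x^\star$ be a minimizer of $F=f+g$ (assumed to exist). Let $x^0\in\operatorname{dom} f\cap\operatorname{dom} g$ and $\xi^0\in\partial g(x^0)$, and assume that either the analytic center $x_f^\star=\arg\min_{\operatorname{int}\mathcal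 X}f$ exists or $\xi^0=0$. Put $\bar c_0=\theta_f\|\xi^0\|^*_{x_f^\star}$ if $x_f^\star$ exists and $\bar c_0=0$ otherwise, where $\theta_f=1$ if $f$ is logarithmically homogeneous ($f(tx)=f(x)-\nu_f\log t$ for all $x\in\operatorname{int}\mathcal X$, $t>0$) and $\theta_f=\nu_f+2\sqrt{\nu_f}$ otherwise. For $\tau\in(0,1]$ let $$x^*_\tau=\arg\min_x\{\tau f(x)-(1-\tau)\langle\xi^0,x\rangle+g(x)\}.$$ **Parameters.** Let $\tau_0\in(0,1)$ and $\sigma\in(0.318642,1]$ satisfy $$C_0:=\frac{\sqrt{\sigma-0.01}}{10}-\frac1{18}>0,\qquad \sigma\ge\Big(1-\frac{\tau_0C_0}{(1-\tau_0)(1+C_0)(\sqrt{\nu_f}+\bar c_0)}\Big)^2,$$ let $\beta=0.05$, and suppose $\|x^0-x^*_{\tau_0}\|_{x^*_{\tau_0}}\le\beta$. **Scheme.** For $k\ge0$ let $$\tau_{k+1}=\min\Big\{1,\Big(1+\frac{\Delta_k}{(1+\Delta_k)(\sqrt{\nu_f}+\bar c_0)}\Big)\tau_k\Big\},\qquad \Delta_k=\Big(\frac{\sqrt{\sigma-0.01}}{10}-\frac{\sqrt\sigma^{\,k}}{18}\Big)\sqrt\sigma^{\,k},$$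 and let $x^{k+1}$ be a $\delta_k$-approximate proximal-Newton step, i.e. $\mathcal P_k(x^{k+1})-\min\mathcal P_k\le\delta_k^2/2$, where $$\mathcal P_k(x)=\big\langle\nabla f(x^k)-(\tfrac1{\tau_{k+1}}-1)\xi^0,x-x^k\big\rangle+\tfrac12\langle\nabla^2f(x^k)(x-x^k),x-x^k\rangle+\tfrac1{\tau_{k+1}}g(x)$$ and $0\le\delta_k\le\frac1{113}\|x^k-x^*_{\tau_k}\|_{x^*_{\tau_k}}$. **Theorem.** The minimizer $x^*_\tau$ exists and is unique for every $\tau\in(0,1]$, and for all $k\ge0$: 1. $\|x^k-x^*_{\tau_k}\|_{x^*_{\tau_k}}\le\beta\sigma^k$ and $0\le 1-\tau_k$. 2. If $\sigma<1$, then $1-\tau_k\le\dfrac{C_0\sqrt\sigma^{\,k}}{(1+C_0)(\sqrt{\nu_f}+\bar c_0)(1-\sqrt\sigma)}$; hence $\|x^k-x^*_{\tau_k}\|_{x^*_{\tau_k}}$ and $1-\tau_k$ both converge to $0$ at a linear rate. 3. If $\widetilde C_1:=\dfrac{C_0}{\tau_0(1+C_0)(1-\sqrt\sigma)-C_0}>0$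 (which forces $\sigma<1$), then for every $k$ with $\widetilde C_1\sqrt\sigma^{\,k}<1$ $$\|x^k-x^\star\|_{x^\star}\le\frac{\beta\sigma^k}{1-\widetilde C_1\sqrt\sigma^{\,k}}+\widetilde C_1\sqrt\sigma^{\,k}.$$ Hence there is a constant $C$ with $\|x^k-x^\star\|_{x^\star}\le C\sqrt\sigma^{\,k}$ for all $k$, and $x^k\to x^\star$ at a linear rate. Moreover, for the given value of $\sqrt{\nu_f}+\bar c_0$ there always exist $\tau_0\in(0,1)$ and $\sigma\in(0.318642,1)$ satisfying the two conditions on the parameters together with $\widetilde C_1>0$. -/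

import Mathlib

open Set Filter Topology

noncomputable section

namespace HomotopyPN

/-- `ℝᵖ` with its Euclidean structure. -/
abbrev Vec (p : ℕ) := EuclideanSpace ℝ (Fin p)

variable {p : ℕ}

/-! ### Local norms -/

/-- The Hessian `∇²f(x)` as a linear operator. -/
def hess (f : Vec p → ℝ) (x : Vec p) : Vec p →L[ℝ] Vec p := fderiv ℝ (gradient f) x

/-- `‖u‖ₓ = ⟨∇²f(x)u, u⟩^{1/2}`. -/
def localNorm (f : Vec p → ℝ) (x u : Vec p) : ℝ := √(inner ℝ (hess f x u) u)

/-- `‖v‖ₓ* = ⟨∇²f(x)⁻¹v, v⟩^{1/2}`. -/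
def dualLocalNorm (f : Vec p → ℝ) (x v : Vec p) : ℝ :=
  √(inner ℝ ((hess f x).inverse v) v)

/-! ### Self-concordant barriers -/

/-- `f` (with `dom f = int X`) is three times continuously differentiable, convex, and
`|⟨∇³f(x)[u]u, u⟩| ≤ 2 ⟨∇²f(x)u, u⟩^{3/2}` on its domain. -/
structure IsStdSelfConcordant (X : Set (Vec p)) (f : Vec p → ℝ) : Prop where
  contDiffOn : ContDiffOn ℝ 3 f (interior X)
  convexOn : ConvexOn ℝ (interior X) f
  third_le : ∀ x ∈ interior X, ∀ u : Vec p,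
    |inner ℝ (fderiv ℝ (hess f) x u u) u| ≤ 2 * (inner ℝ (hess f x u) u) ^ (3 / 2 : ℝ)

/-- `f` is a `ν`-self-concordant barrier of the convex set `X`. -/
structure IsSelfConcordantBarrier (X : Set (Vec p)) (f : Vec p → ℝ) (ν : ℝ) : Prop where
  one_le : 1 ≤ ν
  convex : Convex ℝ X
  selfConcordant : IsStdSelfConcordant X f
  tendsto_boundary : ∀ y ∈ frontier X, Tendsto f (𝓝[interior X] y) atTop
  sup_le : ∀ x ∈ interior X, ∀ u : Vec p,
    2 * inner ℝ (gradient f x) u - localNorm f x u ^ 2 ≤ ν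

/-- Logarithmic homogeneity: `f(t x) = f(x) - ν log t` on `int X` for `t > 0`. -/
def IsLogHomogeneous (X : Set (Vec p)) (f : Vec p → ℝ) (ν : ℝ) : Prop :=
  ∀ x ∈ interior X, ∀ t : ℝ, 0 < t →
    t • x ∈ interior X ∧ f (t • x) = f x - ν * Real.log t

open Classical in
/-- `θ_f`: equal to `1` for logarithmically homogeneous barriers, `ν + 2√ν` otherwise. -/
def theta (X : Set (Vec p)) (f : Vec p → ℝ) (ν : ℝ) : ℝ :=
  if IsLogHomogeneous X f ν then 1 else ν + 2 * √ν

/-! ### Extended-valued convex functions -/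

/-- Proper, closed and convex, for `g : ℝᵖ → ℝ ∪ {+∞}`. -/
structure IsProperClosedConvex (g : Vec p → EReal) : Prop where
  ne_bot : ∀ x, g x ≠ ⊥
  exists_ne_top : ∃ x, g x ≠ ⊤
  closed : LowerSemicontinuous g
  convex_epigraph : Convex ℝ {q : Vec p × ℝ | g q.1 ≤ (q.2 : EReal)}

/-- `ξ ∈ ∂g(x)`. -/
def IsSubgradient (g : Vec p → EReal) (x ξ : Vec p) : Prop :=
  g x ≠ ⊤ ∧ ∀ y, g x + ((inner ℝ ξ (y - x) : ℝ) : EReal) ≤ g y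

open Classical in
/-- The function equal to `h` on `int X` and to `+∞` elsewhere. -/
def extendTop (X : Set (Vec p)) (h : Vec p → ℝ) (x : Vec p) : EReal :=
  if x ∈ interior X then (h x : EReal) else ⊤

/-- `x` is a minimizer, with finite value, of `Φ` over `ℝᵖ`. -/
def IsArgmin (Φ : Vec p → EReal) (x : Vec p) : Prop :=
  Φ x ≠ ⊤ ∧ ∀ y, Φ x ≤ Φ y

open Classical in
/-- A minimizer of `Φ` (the default `0` if there is none). -/
def argmin (Φ : Vec p → EReal) : Vec p :=
  if h : ∃ x, IsArgmin Φ x then h.choose else 0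

/-! ### The composite problem, its parametrization and the scheme -/

/-- `F = f + g`, with `dom f = int X`. -/
def objective (X : Set (Vec p)) (f : Vec p → ℝ) (g : Vec p → EReal) (x : Vec p) : EReal :=
  extendTop X f x + g x

/-- `F_τ = f_τ + g` with `f_τ(x) = τ f(x) - (1 - τ)⟨ξ, x⟩`. -/
def paramObjective (X : Set (Vec p)) (f : Vec p → ℝ) (g : Vec p → EReal) (ξ : Vec p) (τ : ℝ)
    (x : Vec p) : EReal :=
  extendTop X (fun z => τ * f z - (1 - τ) * inner ℝ ξ z) x + g x

/-- `x*_τ`, the minimizer of `F_τ`. -/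
def paramSol (X : Set (Vec p)) (f : Vec p → ℝ) (g : Vec p → EReal) (ξ : Vec p) (τ : ℝ) : Vec p :=
  argmin (paramObjective X f g ξ τ)

/-- `‖x - x*_τ‖` in the local norm at `x*_τ`. -/
def localDist (X : Set (Vec p)) (f : Vec p → ℝ) (g : Vec p → EReal) (ξ : Vec p) (τ : ℝ)
    (x : Vec p) : ℝ :=
  localNorm f (paramSol X f g ξ τ) (x - paramSol X f g ξ τ)

/-- `x` is an analytic center: a minimizer of `f` over `int X`. -/
def IsAnalyticCenter (X : Set (Vec p)) (f : Vec p → ℝ) (x : Vec p) : Prop :=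
  IsArgmin (extendTop X f) x

open Classical in
/-- `c̄₀ = θ_f ‖ξ‖*` in the dual local norm at the analytic center if the latter exists, and `0`
otherwise. -/
def cbar (X : Set (Vec p)) (f : Vec p → ℝ) (ν : ℝ) (ξ : Vec p) : ℝ :=
  if ∃ z, IsAnalyticCenter X f z then
    theta X f ν * dualLocalNorm f (argmin (extendTop X f)) ξ
  else 0

/-- The model at the current iterate `x` for the parameter value `τ`:
`P(z) = ⟨∇f(x) - (1/τ - 1)ξ, z - x⟩ + ½⟨∇²f(x)(z - x), z - x⟩ + (1/τ) g(z)`. -/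
def subproblem (f : Vec p → ℝ) (g : Vec p → EReal) (ξ : Vec p) (τ : ℝ) (x z : Vec p) : EReal :=
  ((inner ℝ (gradient f x - (1 / τ - 1) • ξ) (z - x)
      + 1 / 2 * inner ℝ (hess f x (z - x)) (z - x) : ℝ) : EReal)
    + ((1 / τ : ℝ) : EReal) * g z

/-- `x'` is a `δ`-approximate solution of the proximal-Newton subproblem at `x`: its value
exceeds that of the exact solution by at most `δ²/2`. -/
def IsInexactStep (f : Vec p → ℝ) (g : Vec p → EReal) (ξ : Vec p) (τ δ : ℝ) (x x' : Vec p) :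
    Prop :=
  ∃ xbar, IsArgmin (subproblem f g ξ τ x) xbar ∧
    subproblem f g ξ τ x x' ≤ subproblem f g ξ τ x xbar + ((δ ^ 2 / 2 : ℝ) : EReal)

/-! ### Constants -/

/-- `C₀ = √(σ - 0.01)/10 - 1/18`. -/
def C₀ (σ : ℝ) : ℝ := √(σ - 0.01) / 10 - 1 / 18

/-- `Δ_k = (√(σ - 0.01)/10 - (√σ)^k/18) (√σ)^k`. -/
def Δ (σ : ℝ) (k : ℕ) : ℝ := (√(σ - 0.01) / 10 - √σ ^ k / 18) * √σ ^ k

/-- The condition on `σ`, for given `τ₀` and `s = √ν_f + c̄₀`. -/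
def SigmaCondition (s τ₀ σ : ℝ) : Prop :=
  0 < C₀ σ ∧ (1 - τ₀ * C₀ σ / ((1 - τ₀) * (1 + C₀ σ) * s)) ^ 2 ≤ σ

/-- `C̃₁ = C₀ / (τ₀ (1 + C₀)(1 - √σ) - C₀)`. -/
def Ctilde (τ₀ σ : ℝ) : ℝ := C₀ σ / (τ₀ * (1 + C₀ σ) * (1 - √σ) - C₀ σ)

end HomotopyPN

end

noncomputable section

namespace HomotopyPN

variable {p : ℕ}

/-! ### Derivatives of a `C³` function and their symmetries -/

/-! The scheme follows the path `t ↦ x*_t` from `τ 0` up to the target value `1`, and two errors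
must shrink together: the distance of the iterate to the path and the remaining gap `1 - τ k`. All
estimates use local norms, which are comparable at nearby points because self-concordance, once
polarized to `|third f x u v v| ≤ 2 ‖u‖ₓ ‖v‖ₓ²` (`abs_third_le`), controls the logarithmic
derivative of the Hessian form. Integration along segments gives the comparison of local norms
(`localNorm_le_and_le`), strong monotonicity of the gradient (`le_inner_gradient_sub`) and the
linearization error (`inner_gradient_sub_hess_le`).

The path is Lipschitz in the parameter: adding the optimality conditions at two parameters
eliminates `g` and leaves `(τ' - τ)` times the functional `ξ + ∇f(a)`, whose dual local norm is at
most `s = √ν + c̄₀` (`inner_add_gradient_le`). For nonzero `ξ`, that bound moves a dual norm from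
the analytic center to an arbitrary point: the Dikin ellipsoid there lies in the domain, and the
domain lies in an ellipsoid of radius `ν + 2√ν` about the center.

The update of `τ` is designed so that the path moves by at most `Δ σ k`. The iterate is then close
enough to the new target for the inexact proximal-Newton step to be quadratically accurate
(`localNorm_target_step_le`), and numerical estimates (`step_constants`) turn this into contraction
by `σ`.

Since `Δ σ k ≥ C₀ σ * √σ ^ k`, each uncapped update reduces `1 - τ k` by at least a fixed multiple
of `√σ ^ k`; the condition on `σ` says precisely that the sum of this geometric series covers the
initial gap (`one_sub_tau_le`). The Lipschitz bound between `x*_{τ k}` and `x*_1 = xstar`, together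
with a comparison of local norms, gives the last rate. -/

theorem contDiffAt_gradient {D : Set (Vec p)} {f : Vec p → ℝ} (hD : IsOpen D)
    (hf : ContDiffOn ℝ 3 f D) {x : Vec p} (hx : x ∈ D) : ContDiffAt ℝ 2 (gradient f) x := by
  have h1 : ContDiffAt ℝ 3 f x := hf.contDiffAt (hD.mem_nhds hx)
  have h2 : ContDiffAt ℝ 2 (fderiv ℝ f) x := h1.fderiv_right (by norm_num)
  exact (InnerProductSpace.toDual ℝ (Vec p)).symm.contDiff.contDiffAt.comp x h2

theorem hasFDerivAt_gradient {D : Set (Vec p)} {f : Vec p → ℝ} (hD : IsOpen D)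
    (hf : ContDiffOn ℝ 3 f D) {x : Vec p} (hx : x ∈ D) :
    HasFDerivAt (gradient f) (hess f x) x :=
  ((contDiffAt_gradient hD hf hx).differentiableAt (by norm_num)).hasFDerivAt

theorem hasFDerivAt_hess {D : Set (Vec p)} {f : Vec p → ℝ} (hD : IsOpen D)
    (hf : ContDiffOn ℝ 3 f D) {x : Vec p} (hx : x ∈ D) :
    HasFDerivAt (hess f) (fderiv ℝ (hess f) x) x := by
  have : ContDiffAt ℝ 1 (fderiv ℝ (gradient f)) x :=
    (contDiffAt_gradient hD hf hx).fderiv_right (by norm_num)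
  exact (this.differentiableAt (by norm_num)).hasFDerivAt

theorem hasGradientAt_of_mem {D : Set (Vec p)} {f : Vec p → ℝ} (hD : IsOpen D)
    (hf : ContDiffOn ℝ 3 f D) {x : Vec p} (hx : x ∈ D) :
    HasGradientAt f (gradient f x) x :=
  ((hf.contDiffAt (hD.mem_nhds hx)).differentiableAt (by norm_num)).hasGradientAt

/-- The gradient is the Riesz representative of `fderiv ℝ f`, so pairing `hess` with a vector gives
the second Fréchet derivative, which is symmetric for smooth functions. -/
theorem inner_hess_comm {D : Set (Vec p)} {f : Vec p → ℝ} (hD : IsOpen D)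
    (hf : ContDiffOn ℝ 3 f D) {x : Vec p} (hx : x ∈ D) (u v : Vec p) :
    inner ℝ (hess f x u) v = inner ℝ (hess f x v) u := by
  have h1 : ContDiffAt ℝ 3 f x := hf.contDiffAt (hD.mem_nhds hx)
  have hs : IsSymmSndFDerivAt ℝ f x := h1.isSymmSndFDerivAt (by simp; norm_num)
  have h2 : ContDiffAt ℝ 2 (fderiv ℝ f) x := h1.fderiv_right (by norm_num)
  have key : ∀ a b : Vec p, inner ℝ (hess f x a) b = fderiv ℝ (fderiv ℝ f) x a b := by
    intro a b
    have h3 : HasFDerivAt (fun y => inner ℝ (gradient f y) b)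
        ((innerSL ℝ b).comp (hess f x)) x := by
      have := (innerSL ℝ b).hasFDerivAt.comp x (hasFDerivAt_gradient hD hf hx)
      refine this.congr_of_eventuallyEq (Eventually.of_forall fun y => ?_)
      simp
    have h4 : HasFDerivAt (fun y => fderiv ℝ f y b)
        ((ContinuousLinearMap.apply ℝ ℝ b).comp (fderiv ℝ (fderiv ℝ f) x)) x :=
      (ContinuousLinearMap.apply ℝ ℝ b).hasFDerivAt.comp x
        (h2.differentiableAt (by norm_num)).hasFDerivAt
    have h5 : (fun y => inner ℝ (gradient f y) b) = fun y => fderiv ℝ f y b := by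
      funext y
      simp [gradient]
    rw [h5] at h3
    have := congrArg (fun L => L a) (h3.unique h4)
    simpa [real_inner_comm] using this
  rw [key, key]
  exact hs u v

/-- The third derivative as a trilinear form. -/
def third (f : Vec p → ℝ) (x u v w : Vec p) : ℝ := inner ℝ (fderiv ℝ (hess f) x u v) w

theorem third_comm_left {D : Set (Vec p)} {f : Vec p → ℝ} (hD : IsOpen D)
    (hf : ContDiffOn ℝ 3 f D) {x : Vec p} (hx : x ∈ D) (u v w : Vec p) :
    third f x u v w = third f x v u w := by
  have hs : IsSymmSndFDerivAt ℝ (gradient f) x :=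
    (contDiffAt_gradient hD hf hx).isSymmSndFDerivAt (by simp)
  exact congrArg (fun z => inner ℝ z w) (hs u v)

theorem eventually_line_mem {D : Set (Vec p)} (hD : IsOpen D) {x u : Vec p} {t : ℝ}
    (hx : x + t • u ∈ D) : ∀ᶠ s in 𝓝 t, x + s • u ∈ D := by
  have : ContinuousAt (fun s : ℝ => x + s • u) t := by fun_prop
  exact this.eventually_mem (hD.mem_nhds hx)

theorem hasDerivAt_line (x u : Vec p) (t : ℝ) : HasDerivAt (fun s : ℝ => x + s • u) u t := by
  simpa using ((hasDerivAt_id t).smul_const u).const_add x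

theorem hasDerivAt_inner_hess {D : Set (Vec p)} {f : Vec p → ℝ} (hD : IsOpen D)
    (hf : ContDiffOn ℝ 3 f D) {x u : Vec p} {t : ℝ} (hx : x + t • u ∈ D) (v w : Vec p) :
    HasDerivAt (fun s : ℝ => inner ℝ (hess f (x + s • u) v) w)
      (third f (x + t • u) u v w) t := by
  have h1 := (hasFDerivAt_hess hD hf hx).comp_hasDerivAt t (hasDerivAt_line x u t)
  have h2 := ((ContinuousLinearMap.apply ℝ (Vec p) v).hasFDerivAt.comp_hasDerivAt t h1)
  have h3 := (innerSL ℝ w).hasFDerivAt.comp_hasDerivAt t h2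
  simpa [Function.comp_def, third, real_inner_comm] using h3

theorem hasDerivAt_inner_gradient {D : Set (Vec p)} {f : Vec p → ℝ} (hD : IsOpen D)
    (hf : ContDiffOn ℝ 3 f D) {x u : Vec p} {t : ℝ} (hx : x + t • u ∈ D) (v : Vec p) :
    HasDerivAt (fun s : ℝ => inner ℝ (gradient f (x + s • u)) v)
      (inner ℝ (hess f (x + t • u) u) v) t := by
  have h1 := (hasFDerivAt_gradient hD hf hx).comp_hasDerivAt t (hasDerivAt_line x u t)
  have h3 := (innerSL ℝ v).hasFDerivAt.comp_hasDerivAt t h1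
  simpa [Function.comp_def, real_inner_comm] using h3

theorem hasDerivAt_comp_line {D : Set (Vec p)} {f : Vec p → ℝ} (hD : IsOpen D)
    (hf : ContDiffOn ℝ 3 f D) {x u : Vec p} {t : ℝ} (hx : x + t • u ∈ D) :
    HasDerivAt (fun s : ℝ => f (x + s • u)) (inner ℝ (gradient f (x + t • u)) u) t := by
  have h1 := (hasGradientAt_of_mem hD hf hx).hasFDerivAt.comp_hasDerivAt t (hasDerivAt_line x u t)
  simpa [Function.comp_def] using h1

/-- Differentiating the symmetry of the Hessian along the line in direction `u` gives it. With
`third_comm_left`, the form becomes totally symmetric. -/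
theorem third_comm_right {D : Set (Vec p)} {f : Vec p → ℝ} (hD : IsOpen D)
    (hf : ContDiffOn ℝ 3 f D) {x : Vec p} (hx : x ∈ D) (u v w : Vec p) :
    third f x u v w = third f x u w v := by
  have hx' : x + (0 : ℝ) • u ∈ D := by simpa using hx
  have h1 := hasDerivAt_inner_hess hD hf hx' v w
  have h2 := hasDerivAt_inner_hess hD hf hx' w v
  have h3 : (fun s : ℝ => inner ℝ (hess f (x + s • u) v) w) =ᶠ[𝓝 0]
      fun s : ℝ => inner ℝ (hess f (x + s • u) w) v :=
    (eventually_line_mem hD hx').mono fun s hs => inner_hess_comm hD hf hs v w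
  simpa using (h1.congr_of_eventuallyEq h3.symm).unique h2

/-! ### From the diagonal of a cubic form to its polarization -/

/-- The value of a binary cubic form at a point of the unit circle with triple angle `(K, L)`,
multiplied by the nonnegative weight `((4 c ^ 2 - 1) / 3) ^ 2`. -/
theorem weighted_cubic_le {a b d e M : ℝ}
    (h : ∀ c s : ℝ, c ^ 2 + s ^ 2 = 1 →
      a * c ^ 3 + 3 * b * c ^ 2 * s + 3 * d * c * s ^ 2 + e * s ^ 3 ≤ M)
    {c s K L : ℝ} (hcs : c ^ 2 + s ^ 2 = 1) (hK : 4 * c ^ 3 - 3 * c = K)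
    (hL : 3 * s - 4 * s ^ 3 = L) :
    a * (K ^ 2 * c + 4 * K * c ^ 2 + K + 3 * c) / 9 + 3 * b * L * (K * c + 2 * c ^ 2) / 9
      + 3 * d * L ^ 2 * c / 9 + e * L ^ 2 * s / 9 ≤ M * (4 * K * c + 4 * c ^ 2 + 1) / 9 := by
  have hw : (4 * c ^ 2 - 1) * c = K + 2 * c := by linear_combination hK
  have hs : (4 * c ^ 2 - 1) * s = L := by linear_combination hL + 4 * s * hcs
  have key := mul_le_mul_of_nonneg_left (h c s hcs) (sq_nonneg ((4 * c ^ 2 - 1) / 3))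
  have e1 : ((4 * c ^ 2 - 1) / 3) ^ 2 * M = M * (4 * K * c + 4 * c ^ 2 + 1) / 9 := by
    linear_combination M * 4 * c / 9 * hK
  have e2 : ((4 * c ^ 2 - 1) / 3) ^ 2 *
      (a * c ^ 3 + 3 * b * c ^ 2 * s + 3 * d * c * s ^ 2 + e * s ^ 3) =
      (a * c * ((4 * c ^ 2 - 1) * c) ^ 2 + 3 * b * c * ((4 * c ^ 2 - 1) * c) *
        ((4 * c ^ 2 - 1) * s) + 3 * d * c * ((4 * c ^ 2 - 1) * s) ^ 2
        + e * s * ((4 * c ^ 2 - 1) * s) ^ 2) / 9 := by ring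
  rw [e1, e2, hw, hs] at key
  linear_combination key - a / 9 * hK

/-- If a binary cubic form is bounded by `M` on the unit circle, then so is the
linear form given by its two leading coefficients. -/
theorem cubic_leading_le {a b d e M : ℝ}
    (h : ∀ c s : ℝ, c ^ 2 + s ^ 2 = 1 →
      a * c ^ 3 + 3 * b * c ^ 2 * s + 3 * d * c * s ^ 2 + e * s ^ 3 ≤ M)
    {c s : ℝ} (hcs : c ^ 2 + s ^ 2 = 1) : a * c + b * s ≤ M := by
  obtain ⟨α, rfl, rfl⟩ : ∃ α : ℝ, c = Real.cos α ∧ s = Real.sin α := by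
    obtain ⟨α, hα⟩ := (Complex.norm_eq_one_iff (⟨c, s⟩ : ℂ)).1 (by
      rw [Complex.norm_def, Complex.normSq_mk, ← sq, ← sq, hcs, Real.sqrt_one])
    refine ⟨α, ?_, ?_⟩
    · have := congrArg Complex.re hα
      rw [Complex.exp_ofReal_mul_I_re] at this
      exact this.symm
    · have := congrArg Complex.im hα
      rw [Complex.exp_ofReal_mul_I_im] at this
      exact this.symm
  -- The three angles `γ` and `γ ± 2π/3` share the triple angle `α`. With weights `(sin 3γ / (3 sin
  -- γ))² = ((4 c² - 1) / 3)²`, the average of the cubic form over them is exactly `a cos α + b sin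
  -- α`.
  obtain ⟨γ, rfl⟩ : ∃ γ, α = 3 * γ := ⟨α / 3, by ring⟩
  rw [Real.cos_three_mul, Real.sin_three_mul]
  have hCS : Real.cos γ ^ 2 + Real.sin γ ^ 2 = 1 := Real.cos_sq_add_sin_sq γ
  generalize Real.cos γ = C at *
  generalize Real.sin γ = S at *
  obtain ⟨q, hq⟩ : ∃ q : ℝ, q ^ 2 = 3 := ⟨√3, by norm_num⟩
  have h0 := weighted_cubic_le h hCS rfl rfl
  -- With `q = ±√3` these are the cosine and sine of `γ ± 2π/3`; the claims are that they lie on the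
  -- circle and have unchanged triple angle.
  have key : ∀ q : ℝ, q ^ 2 = 3 →
      (-C / 2 - q / 2 * S) ^ 2 + (-S / 2 + q / 2 * C) ^ 2 = 1 ∧
      4 * (-C / 2 - q / 2 * S) ^ 3 - 3 * (-C / 2 - q / 2 * S) = 4 * C ^ 3 - 3 * C ∧
      3 * (-S / 2 + q / 2 * C) - 4 * (-S / 2 + q / 2 * C) ^ 3 = 3 * S - 4 * S ^ 3 := by
    intro q hq
    have hq3 : q ^ 3 = 3 * q := by linear_combination q * hq
    refine ⟨by linear_combination hCS + (C ^ 2 + S ^ 2) / 4 * hq, ?_, ?_⟩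
    · have hC3 : C * S ^ 2 = C - C ^ 3 := by linear_combination C * hCS
      have hS3 : C ^ 2 * S = S - S ^ 3 := by linear_combination S * hCS
      linear_combination (-3 / 2 * C * S ^ 2) * hq - S ^ 3 / 2 * hq3 - 9 / 2 * hC3 - 3 / 2 * q * hS3
    · have hC3 : C * S ^ 2 = C - C ^ 3 := by linear_combination C * hCS
      have hS3 : C ^ 2 * S = S - S ^ 3 := by linear_combination S * hCS
      linear_combination (3 / 2 * C ^ 2 * S) * hq - C ^ 3 / 2 * hq3 + 9 / 2 * hS3 - 3 / 2 * q * hC3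
  obtain ⟨a1, b1, c1⟩ := key q hq
  obtain ⟨a2, b2, c2⟩ := key (-q) (by rw [neg_sq, hq])
  have h1 := weighted_cubic_le h a1 b1 c1
  have h2 := weighted_cubic_le h a2 b2 c2
  generalize hKd : 4 * C ^ 3 - 3 * C = K at *
  generalize hLd : 3 * S - 4 * S ^ 3 = L at *
  -- The three cosines sum to `0`, as do the sines, and the squared cosines sum to `3/2`. Hence the
  -- weights sum to `1` and the terms in `d` and `e` cancel.
  have hsum : C ^ 2 + (-C / 2 - q / 2 * S) ^ 2 + (-C / 2 - -q / 2 * S) ^ 2 = 3 / 2 := by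
    linear_combination 3 / 2 * hCS + S ^ 2 / 2 * hq
  linear_combination h0 + h1 + h2
    - (4 * a * K / 9 + 6 * b * L / 9 - 4 * M / 9) * hsum

/-! ### Self-concordant functions with positive definite Hessian -/

/-- A `C³` function on an open convex set, with positive definite Hessian, that satisfies the
self-concordance inequality; the inequality is written with the trilinear form `third`. -/
structure IsNondegSelfConcordant (D : Set (Vec p)) (f : Vec p → ℝ) : Prop where
  isOpen : IsOpen D
  convex : Convex ℝ D
  contDiffOn : ContDiffOn ℝ 3 f D
  pos : ∀ x ∈ D, ∀ u : Vec p, u ≠ 0 → 0 < inner ℝ (hess f x u) u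
  third_diag : ∀ x ∈ D, ∀ u : Vec p, |third f x u u u| ≤ 2 * localNorm f x u ^ 3

theorem localNorm_nonneg (f : Vec p → ℝ) (x u : Vec p) : 0 ≤ localNorm f x u := Real.sqrt_nonneg _

theorem localNorm_smul (f : Vec p → ℝ) (x u : Vec p) (c : ℝ) :
    localNorm f x (c • u) = |c| * localNorm f x u := by
  unfold localNorm
  rw [map_smul, real_inner_smul_left, real_inner_smul_right, ← mul_assoc, ← sq,
    Real.sqrt_mul (sq_nonneg c), Real.sqrt_sq_eq_abs]

theorem localNorm_neg (f : Vec p → ℝ) (x u : Vec p) : localNorm f x (-u) = localNorm f x u := by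
  simp [localNorm]

theorem localNorm_sub_rev (f : Vec p → ℝ) (x u v : Vec p) :
    localNorm f x (u - v) = localNorm f x (v - u) := by
  rw [← neg_sub, localNorm_neg]

theorem localNorm_zero (f : Vec p → ℝ) (x : Vec p) : localNorm f x 0 = 0 := by simp [localNorm]

namespace IsNondegSelfConcordant

variable {D : Set (Vec p)} {f : Vec p → ℝ}

theorem inner_hess_nonneg (h : IsNondegSelfConcordant D f)
    {x : Vec p} (hx : x ∈ D) (u : Vec p) : 0 ≤ inner ℝ (hess f x u) u := by
  rcases eq_or_ne u 0 with rfl | hu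
  · simp
  · exact (h.pos x hx u hu).le

theorem localNorm_sq (h : IsNondegSelfConcordant D f)
    {x : Vec p} (hx : x ∈ D) (u : Vec p) : localNorm f x u ^ 2 = inner ℝ (hess f x u) u :=
  Real.sq_sqrt (h.inner_hess_nonneg hx u)

theorem localNorm_pos (h : IsNondegSelfConcordant D f)
    {x : Vec p} (hx : x ∈ D) {u : Vec p} (hu : u ≠ 0) : 0 < localNorm f x u :=
  Real.sqrt_pos.2 (h.pos x hx u hu)

theorem localNorm_eq_zero (h : IsNondegSelfConcordant D f)
    {x : Vec p} (hx : x ∈ D) {u : Vec p} (hu : localNorm f x u = 0) : u = 0 := by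
  by_contra hne
  exact (h.localNorm_pos hx hne).ne' hu

theorem hess_comm (h : IsNondegSelfConcordant D f)
    {x : Vec p} (hx : x ∈ D) (u v : Vec p) :
    inner ℝ (hess f x u) v = inner ℝ (hess f x v) u :=
  inner_hess_comm h.isOpen h.contDiffOn hx u v

theorem localNorm_add_sq (h : IsNondegSelfConcordant D f)
    {x : Vec p} (hx : x ∈ D) (u v : Vec p) :
    localNorm f x (u + v) ^ 2 =
      localNorm f x u ^ 2 + 2 * inner ℝ (hess f x u) v + localNorm f x v ^ 2 := by
  simp only [h.localNorm_sq hx, map_add, inner_add_left, inner_add_right, h.hess_comm hx v u]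
  ring

theorem localNorm_sub_sq (h : IsNondegSelfConcordant D f)
    {x : Vec p} (hx : x ∈ D) (u v : Vec p) :
    localNorm f x (u - v) ^ 2 =
      localNorm f x u ^ 2 - 2 * inner ℝ (hess f x u) v + localNorm f x v ^ 2 := by
  rw [sub_eq_add_neg, h.localNorm_add_sq hx, localNorm_neg, inner_neg_right]
  ring

/-- A bilinear form that is dominated by the Hessian form on the diagonal is dominated by it
everywhere. -/
theorem abs_inner_le_of_diag (h : IsNondegSelfConcordant D f)
    {x : Vec p} (hx : x ∈ D) {A : Vec p →L[ℝ] Vec p} {c : ℝ}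
    (hA : ∀ u v, inner ℝ (A u) v = inner ℝ (A v) u)
    (hc : ∀ u, |inner ℝ (A u) u| ≤ c * localNorm f x u ^ 2) (u v : Vec p) :
    |inner ℝ (A u) v| ≤ c * localNorm f x u * localNorm f x v := by
  rcases eq_or_ne u 0 with rfl | hu
  · simp [localNorm_zero]
  rcases eq_or_ne v 0 with rfl | hv
  · simp [localNorm_zero]
  have hU := h.localNorm_pos hx hu
  have hV := h.localNorm_pos hx hv
  set U := localNorm f x u
  set V := localNorm f x v
  -- Scaling by `V` and `U` gives the two vectors equal local norm, so polarization yields the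
  -- product `U * V` with no loss.
  have h1 := hc (V • u + U • v)
  have h2 := hc (V • u - U • v)
  rw [h.localNorm_add_sq hx, localNorm_smul, localNorm_smul, abs_of_pos hU, abs_of_pos hV] at h1
  rw [h.localNorm_sub_sq hx, localNorm_smul, localNorm_smul, abs_of_pos hU, abs_of_pos hV] at h2
  have e1 : inner ℝ (A (V • u + U • v)) (V • u + U • v) - inner ℝ (A (V • u - U • v))
      (V • u - U • v) = 4 * (U * V) * inner ℝ (A u) v := by
    simp only [map_add, map_sub, map_smul, inner_add_left, inner_add_right, inner_sub_left,
      inner_sub_right, real_inner_smul_left, real_inner_smul_right, hA v u]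
    ring
  have h3 : |4 * (U * V) * inner ℝ (A u) v| ≤ 4 * (U * V) * (c * U * V) := by
    rw [← e1]
    refine (abs_sub _ _).trans ((add_le_add h1 h2).trans (le_of_eq ?_))
    ring
  have hUV : 0 < 4 * (U * V) := by positivity
  rw [abs_mul, abs_of_pos hUV] at h3
  exact le_of_mul_le_mul_left h3 hUV

theorem abs_inner_hess_le (h : IsNondegSelfConcordant D f)
    {x : Vec p} (hx : x ∈ D) (u v : Vec p) :
    |inner ℝ (hess f x u) v| ≤ localNorm f x u * localNorm f x v := by
  have := h.abs_inner_le_of_diag hx (A := hess f x) (c := 1) (h.hess_comm hx)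
    (fun u => by rw [h.localNorm_sq hx, abs_of_nonneg (h.inner_hess_nonneg hx u), one_mul]) u v
  rwa [one_mul] at this

theorem localNorm_add_le (h : IsNondegSelfConcordant D f)
    {x : Vec p} (hx : x ∈ D) (u v : Vec p) :
    localNorm f x (u + v) ≤ localNorm f x u + localNorm f x v := by
  refine abs_le_of_sq_le_sq' ?_ (add_nonneg (localNorm_nonneg _ _ _) (localNorm_nonneg _ _ _)) |>.2
  rw [h.localNorm_add_sq hx]
  nlinarith [(abs_le.1 (h.abs_inner_hess_le hx u v)).2]

/-- The polarized form of the self-concordance inequality. -/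
theorem abs_third_le (h : IsNondegSelfConcordant D f)
    {x : Vec p} (hx : x ∈ D) (u v : Vec p) :
    |third f x u v v| ≤ 2 * localNorm f x u * localNorm f x v ^ 2 := by
  have sw1 := third_comm_left h.isOpen h.contDiffOn hx
  have sw2 := third_comm_right h.isOpen h.contDiffOn hx
  -- the unit vector case, without absolute value
  have unit : ∀ u v : Vec p, localNorm f x v = 1 → third f x u v v ≤ 2 * localNorm f x u := by
    intro u v hv
    rcases eq_or_ne u 0 with rfl | hu
    · simp [third, localNorm_zero]
    have hR := h.localNorm_pos hx hu
    obtain ⟨k, hk⟩ : ∃ k, k = inner ℝ (hess f x u) v := ⟨_, rfl⟩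
    obtain ⟨w, hw⟩ : ∃ w, w = u - k • v := ⟨_, rfl⟩
    have huw : u = k • v + w := by rw [hw]; abel
    have hvw : inner ℝ (hess f x v) w = 0 := by
      rw [hw, inner_sub_right, real_inner_smul_right, h.hess_comm hx v u, ← hk,
        ← h.localNorm_sq hx, hv]
      ring
    obtain ⟨m, hm⟩ : ∃ m, m = localNorm f x w := ⟨_, rfl⟩
    have hm0 : 0 ≤ m := hm ▸ localNorm_nonneg f x w
    -- Gram–Schmidt in the Hessian inner product: `u = k • v + m • e` with `e` orthogonal to `v`. If
    -- `w = 0` then `e = 0`, which is why only `localNorm f x e ≤ 1` is recorded below. On the plane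
    -- of `v` and `e` the third derivative becomes a binary cubic form.
    obtain ⟨e, he⟩ : ∃ e, e = m⁻¹ • w := ⟨_, rfl⟩
    have hwe : w = m • e := by
      rcases eq_or_ne m 0 with h0 | h0
      · rw [h0, zero_smul]
        exact h.localNorm_eq_zero hx (hm ▸ h0)
      · rw [he, smul_inv_smul₀ h0]
    have hve : inner ℝ (hess f x v) e = 0 := by
      rw [he, real_inner_smul_right, hvw, mul_zero]
    have hne : localNorm f x e ≤ 1 := by
      rw [he, localNorm_smul, abs_inv, abs_of_nonneg hm0, ← hm]
      exact inv_mul_le_one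
    have hcirc : ∀ c s : ℝ, localNorm f x (c • v + s • e) ^ 2 =
        c ^ 2 + s ^ 2 * localNorm f x e ^ 2 := by
      intro c s
      rw [h.localNorm_add_sq hx, localNorm_smul, localNorm_smul, mul_pow, mul_pow, sq_abs, sq_abs,
        map_smul, real_inner_smul_left, real_inner_smul_right, hve, hv]
      ring
    have hRsq : localNorm f x u ^ 2 = k ^ 2 + m ^ 2 := by
      rw [hwe] at huw
      have h2 := hcirc k m
      rw [← huw] at h2
      rw [h2, hm]
      congr 1
      rw [hm] at hwe
      conv_rhs => rw [hwe, localNorm_smul, abs_of_nonneg (localNorm_nonneg _ _ _)]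
      ring
    have hexp : ∀ c s : ℝ, third f x (c • v + s • e) (c • v + s • e) (c • v + s • e) =
        third f x v v v * c ^ 3 + 3 * third f x e v v * c ^ 2 * s
          + 3 * third f x e e v * c * s ^ 2 + third f x e e e * s ^ 3 := by
      intro c s
      have e1 : third f x v v e = third f x e v v := by rw [sw2, sw1]
      have e2 : third f x v e v = third f x e v v := by rw [sw1]
      have e3 : third f x v e e = third f x e e v := by rw [sw1, sw2]
      have e4 : third f x e v e = third f x e e v := by rw [sw2]
      simp only [third, map_add, map_smul, add_apply, inner_add_left,
        inner_add_right, smul_apply, real_inner_smul_left,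
        real_inner_smul_right] at e1 e2 e3 e4 ⊢
      rw [e1, e2, e3, e4]
      ring
    have hbound : ∀ c s : ℝ, c ^ 2 + s ^ 2 = 1 →
        third f x v v v * c ^ 3 + 3 * third f x e v v * c ^ 2 * s
          + 3 * third f x e e v * c * s ^ 2 + third f x e e e * s ^ 3 ≤ 2 := by
      intro c s hcs
      rw [← hexp]
      refine (le_abs_self _).trans ((h.third_diag x hx _).trans ?_)
      have hle : localNorm f x (c • v + s • e) ≤ 1 := by
        refine abs_le_of_sq_le_sq' ?_ zero_le_one |>.2
        rw [hcirc]
        have := mul_le_of_le_one_right (sq_nonneg s)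
          (pow_le_one₀ (n := 2) (localNorm_nonneg f x e) hne)
        linarith
      have := pow_le_one₀ (n := 3) (localNorm_nonneg f x (c • v + s • e)) hle
      linarith
    have key := cubic_leading_le hbound (c := k / localNorm f x u) (s := m / localNorm f x u)
      (by rw [div_pow, div_pow, ← add_div, ← hRsq, div_self (by positivity)])
    have e0 : third f x u v v = third f x v v v * k + third f x e v v * m := by
      conv_lhs => rw [huw, hwe]
      simp only [third, map_add, map_smul, add_apply, inner_add_left,
        smul_apply, real_inner_smul_left]
      ring
    rw [mul_div_assoc', mul_div_assoc', ← add_div, ← e0, div_le_iff₀ hR] at key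
    exact key
  rcases eq_or_ne v 0 with rfl | hv
  · simp [third, localNorm_zero]
  have hn := h.localNorm_pos hx hv
  obtain ⟨n, hnd⟩ : ∃ n, n = localNorm f x v := ⟨_, rfl⟩
  rw [← hnd] at hn ⊢
  have h1 : localNorm f x (n⁻¹ • v) = 1 := by
    rw [localNorm_smul, abs_inv, abs_of_pos hn, ← hnd, inv_mul_cancel₀ hn.ne']
  have e1 : ∀ u, third f x u (n⁻¹ • v) (n⁻¹ • v) = third f x u v v / n ^ 2 := by
    intro u
    simp only [third, map_smul, real_inner_smul_left, real_inner_smul_right]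
    field_simp
  have h2 := unit u _ h1
  have h3 := unit (-u) _ h1
  have e2 : third f x (-u) v v = - third f x u v v := by simp [third]
  rw [e1, div_le_iff₀ (by positivity)] at h2 h3
  rw [e2, localNorm_neg] at h3
  exact abs_le.2 ⟨by linarith, h2⟩

end IsNondegSelfConcordant

/-! ### Basic inequalities for self-concordant functions -/

/-- Comparison of increments of two functions with ordered derivatives. -/
theorem sub_le_sub_of_hasDerivAt_le {F G F' G' : ℝ → ℝ} {T : ℝ} (hT : 0 ≤ T)
    (hF : ∀ t ∈ Icc 0 T, HasDerivAt F (F' t) t) (hG : ∀ t ∈ Icc 0 T, HasDerivAt G (G' t) t)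
    (hle : ∀ t ∈ Icc 0 T, F' t ≤ G' t) : F T - F 0 ≤ G T - G 0 := by
  have hd : ∀ t ∈ Icc 0 T, HasDerivAt (fun t => G t - F t) (G' t - F' t) t :=
    fun t ht => (hG t ht).sub (hF t ht)
  have hmono : MonotoneOn (fun t => G t - F t) (Icc 0 T) := by
    refine monotoneOn_of_deriv_nonneg (convex_Icc 0 T)
      (fun t ht => (hd t ht).continuousAt.continuousWithinAt)
      (fun t ht => (hd t (interior_subset ht)).differentiableAt.differentiableWithinAt) ?_
    intro t ht
    rw [(hd t (interior_subset ht)).deriv]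
    exact sub_nonneg.2 (hle t (interior_subset ht))
  have := hmono (left_mem_Icc.2 hT) (right_mem_Icc.2 hT) hT
  simp only at this
  linarith

theorem hasDerivAt_inv_one_sub (r : ℝ) {t : ℝ} (ht : 1 - t * r ≠ 0) :
    HasDerivAt (fun s : ℝ => (1 - s * r)⁻¹) (r / (1 - t * r) ^ 2) t := by
  have := (((hasDerivAt_id t).mul_const r).const_sub 1).inv (by simpa using ht)
  rw [show (fun s : ℝ => (1 - s * r)⁻¹) = (fun s : ℝ => 1 - id s * r)⁻¹ from rfl]
  simpa using this

namespace IsNondegSelfConcordant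

variable {D : Set (Vec p)} {f : Vec p → ℝ}

theorem segment_mem (h : IsNondegSelfConcordant D f) {x u : Vec p} (hx : x ∈ D) (hu : x + u ∈ D)
    {t : ℝ} (ht : t ∈ Icc (0 : ℝ) 1) : x + t • u ∈ D := by
  have := h.convex.add_smul_sub_mem hx hu ht
  simpa using this

/-- Along a line, the inverse of the local norm of the direction is `1`-Lipschitz. -/
theorem abs_inv_localNorm_sub_le (h : IsNondegSelfConcordant D f) {x u : Vec p} (hu : u ≠ 0)
    {T : ℝ} (hT : 0 ≤ T) (hseg : ∀ t ∈ Icc 0 T, x + t • u ∈ D) :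
    |(localNorm f (x + T • u) u)⁻¹ - (localNorm f x u)⁻¹| ≤ T := by
  have hd : ∀ t ∈ Icc 0 T, ∃ d, HasDerivAt (fun s : ℝ => (localNorm f (x + s • u) u)⁻¹) d t ∧
      |d| ≤ 1 := by
    intro t ht
    have hm := hseg t ht
    have hpos := h.localNorm_pos hm hu
    have h1 := ((hasDerivAt_inner_hess h.isOpen h.contDiffOn hm u u).sqrt
      (h.pos _ hm u hu).ne').inv hpos.ne'
    refine ⟨_, h1, ?_⟩
    have h2 := h.third_diag _ hm u
    -- The derivative of `1 / ‖u‖` along the line is `-third / (2 ‖u‖³)`, so the diagonal inequality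
    -- bounds it by exactly `1`.
    change |-(third f (x + t • u) u u u / (2 * localNorm f (x + t • u) u)) /
      localNorm f (x + t • u) u ^ 2| ≤ 1
    rw [abs_div, abs_neg, abs_div, abs_of_pos (by positivity : 0 < 2 * localNorm f (x + t • u) u),
      abs_of_pos (by positivity : 0 < localNorm f (x + t • u) u ^ 2), div_div,
      div_le_one (by positivity)]
    linarith
  choose! d hd1 hd2 using hd
  have := (convex_Icc 0 T).norm_image_sub_le_of_norm_hasDerivWithin_le
    (fun t ht => (hd1 t ht).hasDerivWithinAt) hd2 (left_mem_Icc.2 hT) (right_mem_Icc.2 hT)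
  simpa [abs_of_nonneg hT] using this

/-- The Lipschitz bound `1 / ‖u‖_{x+Tu} ≥ 1 / ‖u‖ₓ - T`, inverted; the companion lower bound comes
from the opposite inequality. -/
theorem localNorm_line_le (h : IsNondegSelfConcordant D f) {x u : Vec p} {T : ℝ} (hT : 0 ≤ T)
    (hseg : ∀ t ∈ Icc 0 T, x + t • u ∈ D) (hr : T * localNorm f x u < 1) :
    localNorm f (x + T • u) u ≤ localNorm f x u / (1 - T * localNorm f x u) := by
  rcases eq_or_ne u 0 with rfl | hu
  · simp [localNorm_zero]
  have h0 : x ∈ D := by simpa using hseg 0 (left_mem_Icc.2 hT)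
  have h1 := h.localNorm_pos h0 hu
  have h2 := h.localNorm_pos (hseg T (right_mem_Icc.2 hT)) hu
  have h3 := (abs_le.1 (h.abs_inv_localNorm_sub_le hu hT hseg)).1
  rw [le_div_iff₀ (by linarith)]
  field_simp at h3
  linarith

theorem le_localNorm_line (h : IsNondegSelfConcordant D f) {x u : Vec p} {T : ℝ} (hT : 0 ≤ T)
    (hseg : ∀ t ∈ Icc 0 T, x + t • u ∈ D) :
    localNorm f x u / (1 + T * localNorm f x u) ≤ localNorm f (x + T • u) u := by
  rcases eq_or_ne u 0 with rfl | hu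
  · simp [localNorm_zero]
  have h0 : x ∈ D := by simpa using hseg 0 (left_mem_Icc.2 hT)
  have h1 := h.localNorm_pos h0 hu
  have h2 := h.localNorm_pos (hseg T (right_mem_Icc.2 hT)) hu
  have h3 := (abs_le.1 (h.abs_inv_localNorm_sub_le hu hT hseg)).2
  rw [div_le_iff₀ (by positivity)]
  field_simp at h3
  linarith

/-- Lower bound on the monotonicity of the gradient. -/
theorem le_inner_gradient_sub (h : IsNondegSelfConcordant D f) {x y : Vec p} (hx : x ∈ D)
    (hy : y ∈ D) :
    localNorm f x (y - x) ^ 2 / (1 + localNorm f x (y - x)) ≤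
      inner ℝ (gradient f y - gradient f x) (y - x) := by
  obtain ⟨u, rfl⟩ : ∃ u, y = x + u := ⟨y - x, by abel⟩
  rw [add_sub_cancel_left]
  have hseg := fun t ht => h.segment_mem hx hy (t := t) ht
  set r := localNorm f x u with hr
  have hr0 : 0 ≤ r := localNorm_nonneg f x u
  -- Integrates `(r / (1 + t r))²`, whose primitive is `-r / (1 + t r)`; the sign is placed as `1 -
  -- t * (-r)` to fit `hasDerivAt_inv_one_sub`.
  have key := sub_le_sub_of_hasDerivAt_le zero_le_one
    (F := fun t => - (r * (1 - t * (-r))⁻¹)) (F' := fun t => - (r * (-r / (1 - t * (-r)) ^ 2)))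
    (G := fun t => inner ℝ (gradient f (x + t • u)) u)
    (G' := fun t => inner ℝ (hess f (x + t • u) u) u)
    (fun t ht => ((hasDerivAt_inv_one_sub (-r) (by nlinarith [ht.1])).const_mul r).neg)
    (fun t ht => hasDerivAt_inner_gradient h.isOpen h.contDiffOn (hseg t ht) u)
    (fun t ht => by
      have h1 := h.le_localNorm_line ht.1 (fun s hs => hseg s ⟨hs.1, hs.2.trans ht.2⟩)
      have h2 : 0 < 1 + t * r := by nlinarith [ht.1]
      rw [← h.localNorm_sq (hseg t ht)]
      calc -(r * (-r / (1 - t * (-r)) ^ 2)) = (r / (1 + t * r)) ^ 2 := by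
            field_simp
            ring
        _ ≤ _ := pow_le_pow_left₀ (by positivity) h1 2)
  simp only [one_smul, zero_smul, add_zero] at key
  rw [inner_sub_left]
  refine le_trans (le_of_eq ?_) key
  have : 1 + r ≠ 0 := by positivity
  have e : (1 : ℝ) - 1 * -r = 1 + r := by ring
  rw [e]
  field_simp
  ring

/-- Comparison of the local norms at two nearby points. -/
theorem localNorm_le_and_le (h : IsNondegSelfConcordant D f) {x y : Vec p} (hx : x ∈ D)
    (hy : y ∈ D) (hr : localNorm f x (y - x) < 1) (v : Vec p) :
    localNorm f y v ≤ localNorm f x v / (1 - localNorm f x (y - x)) ∧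
      (1 - localNorm f x (y - x)) * localNorm f x v ≤ localNorm f y v := by
  obtain ⟨u, rfl⟩ : ∃ u, y = x + u := ⟨y - x, by abel⟩
  rw [add_sub_cancel_left] at hr ⊢
  have hseg := fun t ht => h.segment_mem hx hy (t := t) ht
  set r := localNorm f x u with hrd
  have hr0 : 0 ≤ r := localNorm_nonneg f x u
  have hpos : ∀ t ∈ Icc (0 : ℝ) 1, 0 < 1 - t * r := fun t ht => by nlinarith [ht.1, ht.2]
  have hthird : ∀ t ∈ Icc (0 : ℝ) 1, |third f (x + t • u) u v v| ≤
      2 * (r / (1 - t * r)) * inner ℝ (hess f (x + t • u) v) v := by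
    intro t ht
    have hm := hseg t ht
    rw [← h.localNorm_sq hm]
    refine (h.abs_third_le hm u v).trans ?_
    have h1 := h.localNorm_line_le (T := t) ht.1 (fun s hs => hseg s ⟨hs.1, hs.2.trans ht.2⟩)
      (by have := hpos t ht; linarith)
    gcongr
  have hψ : ∀ t ∈ Icc (0 : ℝ) 1, HasDerivAt (fun s : ℝ => inner ℝ (hess f (x + s • u) v) v)
      (third f (x + t • u) u v v) t :=
    fun t ht => hasDerivAt_inner_hess h.isOpen h.contDiffOn (hseg t ht) v v
  have hlin : ∀ t : ℝ, HasDerivAt (fun s : ℝ => 1 - s * r) (-r) t := fun t => by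
    simpa using ((hasDerivAt_id t).mul_const r).const_sub 1
  -- For `ψ(t) = ‖v‖²` at `x + t u`, the bound `|ψ'| ≤ 2 r ψ / (1 - t r)` makes `ψ (1 - t r)²`
  -- nonincreasing and `ψ (1 - t r)⁻²` nondecreasing.
  have up := sub_le_sub_of_hasDerivAt_le zero_le_one
    (fun t ht => (hψ t ht).mul ((hlin t).pow 2)) (fun t _ => hasDerivAt_const t (0 : ℝ))
    (fun t ht => by
      have h1 := (abs_le.1 (hthird t ht)).2
      have h2 := hpos t ht
      have h3 := mul_le_mul_of_nonneg_right h1 (sq_nonneg (1 - t * r))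
      have h4 : 2 * (r / (1 - t * r)) * inner ℝ (hess f (x + t • u) v) v * (1 - t * r) ^ 2 =
          2 * r * (1 - t * r) * inner ℝ (hess f (x + t • u) v) v := by field_simp
      rw [h4] at h3
      simp
      linarith)
  have lo := sub_le_sub_of_hasDerivAt_le zero_le_one (fun t _ => hasDerivAt_const t (0 : ℝ))
    (fun t ht => (hψ t ht).mul ((hasDerivAt_inv_one_sub r (hpos t ht).ne').pow 2))
    (fun t ht => by
      have h1 := (abs_le.1 (hthird t ht)).1
      have h2 := hpos t ht
      have h3 := mul_le_mul_of_nonneg_right h1 (sq_nonneg (1 - t * r)⁻¹)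
      have h4 : -(2 * (r / (1 - t * r)) * inner ℝ (hess f (x + t • u) v) v) * (1 - t * r)⁻¹ ^ 2 =
          - (inner ℝ (hess f (x + t • u) v) v * (2 * (1 - t * r)⁻¹ * (r / (1 - t * r) ^ 2))) := by
        field_simp
      rw [h4] at h3
      simp at h3 ⊢
      linarith)
  have h1r : 0 < 1 - r := by linarith
  simp only [Pi.mul_apply, Pi.pow_apply, one_smul, zero_smul, add_zero, one_mul, zero_mul, sub_zero,
    one_pow, mul_one, inv_one, ← h.localNorm_sq hx, ← h.localNorm_sq hy, sub_self] at up lo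
  have n1 := localNorm_nonneg f x v
  have n2 := localNorm_nonneg f (x + u) v
  constructor
  · rw [le_div_iff₀ h1r]
    refine abs_le_of_sq_le_sq' ?_ n1 |>.2
    linarith [mul_pow (localNorm f (x + u) v) (1 - r) 2]
  · refine abs_le_of_sq_le_sq' ?_ n2 |>.2
    rw [← mul_pow] at lo
    have := pow_le_pow_left₀ n1 (abs_le_of_sq_le_sq' (by linarith : localNorm f x v ^ 2 ≤
      (localNorm f (x + u) v * (1 - r)⁻¹) ^ 2) (by positivity) |>.2) 1
    refine pow_le_pow_left₀ (by positivity) ?_ 2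
    rw [pow_one, pow_one, ← div_eq_mul_inv, le_div_iff₀ h1r] at this
    linarith

/-- Error of the linearization of the gradient, tested against a vector. -/
theorem inner_gradient_sub_hess_le (h : IsNondegSelfConcordant D f) {x y : Vec p} (hx : x ∈ D)
    (hy : y ∈ D) (hr : localNorm f x (y - x) < 1) (v : Vec p) :
    inner ℝ (gradient f y - gradient f x - hess f x (y - x)) v ≤
      localNorm f x (y - x) ^ 2 / (1 - localNorm f x (y - x)) * localNorm f x v := by
  obtain ⟨u, rfl⟩ : ∃ u, y = x + u := ⟨y - x, by abel⟩
  rw [add_sub_cancel_left] at hr ⊢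
  have hseg := fun t ht => h.segment_mem hx hy (t := t) ht
  set r := localNorm f x u with hrd
  have hr0 : 0 ≤ r := localNorm_nonneg f x u
  have hpos : ∀ t ∈ Icc (0 : ℝ) 1, 0 < 1 - t * r := fun t ht => by nlinarith [ht.1, ht.2]
  have hdiff : ∀ t ∈ Icc (0 : ℝ) 1,
      inner ℝ ((hess f (x + t • u) - hess f x) u) v ≤
        (((1 - t * r) ^ 2)⁻¹ - 1) * r * localNorm f x v := by
    intro t ht
    have hm := hseg t ht
    have hp := hpos t ht
    refine (le_abs_self _).trans (h.abs_inner_le_of_diag hx ?_ ?_ u v)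
    · intro a b
      simp only [sub_apply, inner_sub_left, h.hess_comm hm a b, h.hess_comm hx a b]
    · intro w
      have hn : localNorm f x (x + t • u - x) = t * r := by
        rw [add_sub_cancel_left, localNorm_smul, abs_of_nonneg ht.1]
      obtain ⟨h1, h2⟩ := h.localNorm_le_and_le hx hm (by rw [hn]; linarith) w
      rw [hn] at h1 h2
      have h1' := pow_le_pow_left₀ (localNorm_nonneg _ _ _) h1 2
      have h2' := pow_le_pow_left₀ (mul_nonneg hp.le (localNorm_nonneg _ _ _)) h2 2
      rw [div_pow, div_eq_mul_inv] at h1'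
      rw [mul_pow] at h2'
      simp only [sub_apply, inner_sub_left, ← h.localNorm_sq hm, ← h.localNorm_sq hx]
      -- This is `2 - z ≤ 1/z`: the lower deviation `1 - z` of the Hessian form is no larger than
      -- the upper one `1/z - 1`, so one constant bounds the absolute value.
      have hq : 2 - (1 - t * r) ^ 2 ≤ ((1 - t * r) ^ 2)⁻¹ := by
        have hqp : 0 < (1 - t * r) ^ 2 := by positivity
        rw [← sub_nonneg]
        have : ((1 - t * r) ^ 2)⁻¹ - (2 - (1 - t * r) ^ 2) =
          ((1 - t * r) ^ 2 - 1) ^ 2 / (1 - t * r) ^ 2 := by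
          field_simp
          ring
        rw [this]
        positivity
      have := mul_le_mul_of_nonneg_right hq (sq_nonneg (localNorm f x w))
      rw [abs_le]
      constructor <;> linarith
  have key := sub_le_sub_of_hasDerivAt_le zero_le_one
    (F := fun t => inner ℝ (gradient f (x + t • u)) v - t * inner ℝ (hess f x u) v)
    (F' := fun t => inner ℝ (hess f (x + t • u) u) v - 1 * inner ℝ (hess f x u) v)
    (G := fun t => ((1 - t * r)⁻¹ - t * r) * localNorm f x v)
    (G' := fun t => (r / (1 - t * r) ^ 2 - 1 * r) * localNorm f x v)
    (fun t ht => (hasDerivAt_inner_gradient h.isOpen h.contDiffOn (hseg t ht) v).sub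
      ((hasDerivAt_id t).mul_const _))
    (fun t ht => (((hasDerivAt_inv_one_sub r (hpos t ht).ne').sub
      ((hasDerivAt_id t).mul_const r)).mul_const _))
    (fun t ht => by
      have := hdiff t ht
      rw [sub_apply, inner_sub_left] at this
      rw [one_mul]
      refine this.trans (le_of_eq ?_)
      ring)
  simp only [one_smul, zero_smul, add_zero, one_mul, zero_mul, sub_zero, inv_one] at key
  simp only [inner_sub_left]
  have h1r : 1 - r ≠ 0 := by linarith
  have e : r ^ 2 / (1 - r) * localNorm f x v =
      ((1 - r)⁻¹ - r) * localNorm f x v - localNorm f x v := by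
    field_simp
    ring
  rw [e]
  linarith

/-- Monotonicity of the gradient, integrated along the segment; convexity of `f` is not among the
fields of `IsNondegSelfConcordant`. -/
theorem add_inner_gradient_le (h : IsNondegSelfConcordant D f) {x y : Vec p} (hx : x ∈ D)
    (hy : y ∈ D) : f x + inner ℝ (gradient f x) (y - x) ≤ f y := by
  obtain ⟨u, rfl⟩ : ∃ u, y = x + u := ⟨y - x, by abel⟩
  rw [add_sub_cancel_left]
  have hseg := fun t ht => h.segment_mem hx hy (t := t) ht
  have key := sub_le_sub_of_hasDerivAt_le zero_le_one
    (F := fun t => t * inner ℝ (gradient f x) u)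
    (F' := fun _ => 1 * inner ℝ (gradient f x) u)
    (G := fun t => f (x + t • u)) (G' := fun t => inner ℝ (gradient f (x + t • u)) u)
    (fun t _ => (hasDerivAt_id t).mul_const _)
    (fun t ht => hasDerivAt_comp_line h.isOpen h.contDiffOn (hseg t ht))
    (fun t ht => by
      rcases ht.1.eq_or_lt with rfl | ht0
      · simp
      have h1 := h.le_inner_gradient_sub hx (hseg t ht)
      have h2 := localNorm_nonneg f x (x + t • u - x)
      have h3 := (by positivity : 0 ≤ localNorm f x (x + t • u - x) ^ 2 /
        (1 + localNorm f x (x + t • u - x))).trans h1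
      rw [add_sub_cancel_left, real_inner_smul_right, inner_sub_left] at h3
      have := nonneg_of_mul_nonneg_right h3 ht0
      linarith)
  simp only [one_smul, zero_smul, add_zero, one_mul, zero_mul, sub_zero] at key
  linarith

/-- A lower bound with linear growth at infinity. -/
theorem add_inner_gradient_add_le (h : IsNondegSelfConcordant D f) {x y : Vec p}
    (hx : x ∈ D) (hy : y ∈ D) :
    f x + inner ℝ (gradient f x) (y - x) +
      (localNorm f x (y - x) / 2) ^ 2 / (1 + localNorm f x (y - x) / 2) ≤ f y := by
  obtain ⟨u, rfl⟩ : ∃ u, y = x + u := ⟨y - x, by abel⟩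
  -- Tangent inequalities from `x` to the midpoint and from the midpoint to `y` are added; the
  -- growth of the gradient over the first half supplies the extra term.
  have hm := h.segment_mem hx hy (t := 1 / 2) ⟨by norm_num, by norm_num⟩
  have h1 := h.add_inner_gradient_le hx hm
  have h2 := h.add_inner_gradient_le hm hy
  have h3 := h.le_inner_gradient_sub hx hm
  have e : x + u - (x + (1 / 2 : ℝ) • u) = (1 / 2 : ℝ) • u := by module
  rw [e] at h2
  rw [add_sub_cancel_left] at h1 h3 ⊢
  rw [localNorm_smul, abs_of_pos (by norm_num), inner_sub_left] at h3
  rw [real_inner_smul_right] at h1 h2 h3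
  rw [real_inner_smul_right] at h3
  rw [one_div_mul_eq_div] at h3
  linarith

/-- An interior minimizer is a critical point. -/
theorem gradient_eq_zero (h : IsNondegSelfConcordant D f) {z : Vec p} (hz : z ∈ D)
    (hmin : ∀ y ∈ D, f z ≤ f y) : gradient f z = 0 := by
  have : IsLocalMin f z := Filter.mem_of_superset (h.isOpen.mem_nhds hz) hmin
  rw [gradient, this.fderiv_eq_zero, map_zero]

/-- The Dikin ellipsoid is contained in the domain. -/
theorem dikin_mem (h : IsNondegSelfConcordant D f)
    (hb : ∀ y ∈ closure D, y ∉ D → Tendsto f (𝓝[D] y) atTop) {x u : Vec p} (hx : x ∈ D)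
    (hr : localNorm f x u < 1) : x + u ∈ D := by
  by_contra hxu
  have hline : Continuous (fun t : ℝ => x + t • u) := by fun_prop
  -- `T` is the first exit time from the open set `D`. Before it the local norm of `u` is at most `r
  -- / (1 - r)`, so the slope and then `f` stay bounded, contradicting the blow-up at the boundary.
  obtain ⟨T, ⟨⟨hT0, hT1⟩, hTD⟩, hTmin⟩ : ∃ T, IsLeast (Icc (0 : ℝ) 1 ∩ {t | x + t • u ∉ D}) T := by
    refine IsCompact.exists_isLeast ?_ ⟨1, ⟨zero_le_one, le_rfl⟩, by simpa using hxu⟩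
    exact isCompact_Icc.inter_right ((h.isOpen.preimage hline).isClosed_compl)
  have hin : ∀ t ∈ Ico 0 T, x + t • u ∈ D := by
    intro t ht
    by_contra hne
    exact absurd (hTmin ⟨⟨ht.1, ht.2.le.trans hT1⟩, hne⟩) (not_le.2 ht.2)
  have hT : 0 < T := by
    rcases hT0.eq_or_lt with rfl | h0
    · exact absurd (by simpa using hx) hTD
    · exact h0
  set r := localNorm f x u with hrd
  have hr0 : 0 ≤ r := localNorm_nonneg f x u
  have hrr : 0 < 1 - r := by linarith
  set Q := (r / (1 - r)) ^ 2 with hQ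
  set G := |inner ℝ (gradient f x) u| + Q with hG
  have hgrad : ∀ t ∈ Ico 0 T, inner ℝ (gradient f (x + t • u)) u ≤ G := by
    intro t ht
    have hs : ∀ s ∈ Icc 0 t, x + s • u ∈ D := fun s hs => hin s ⟨hs.1, hs.2.trans_lt ht.2⟩
    have key := sub_le_sub_of_hasDerivAt_le ht.1
      (F := fun t => inner ℝ (gradient f (x + t • u)) u)
      (F' := fun t => inner ℝ (hess f (x + t • u) u) u)
      (G := fun t => t * Q) (G' := fun _ => 1 * Q)
      (fun s hs' => hasDerivAt_inner_gradient h.isOpen h.contDiffOn (hs s hs') u)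
      (fun s _ => (hasDerivAt_id s).mul_const _)
      (fun s hs' => by
        have hs1 : s ≤ 1 := hs'.2.trans (ht.2.le.trans hT1)
        have hsr : s * r ≤ r := mul_le_of_le_one_left hr0 hs1
        have h1 := h.localNorm_line_le hs'.1 (fun s' h' => hs s' ⟨h'.1, h'.2.trans hs'.2⟩)
          (lt_of_le_of_lt hsr hr)
        rw [← h.localNorm_sq (hs s hs'), one_mul, hQ]
        refine pow_le_pow_left₀ (localNorm_nonneg _ _ _) (h1.trans ?_) 2
        gcongr)
    simp only [zero_smul, add_zero, zero_mul, sub_zero] at key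
    have h1 : t * Q ≤ Q := mul_le_of_le_one_left (sq_nonneg _) (ht.2.le.trans hT1)
    have h2 := le_abs_self (inner ℝ (gradient f x) u)
    linarith
  have hG0 : 0 ≤ G := by positivity
  have hbd : ∀ t ∈ Ico 0 T, f (x + t • u) ≤ f x + G := by
    intro t ht
    have hs : ∀ s ∈ Icc 0 t, s ∈ Ico 0 T := fun s hs => ⟨hs.1, hs.2.trans_lt ht.2⟩
    have key := sub_le_sub_of_hasDerivAt_le ht.1
      (F := fun t => f (x + t • u)) (F' := fun t => inner ℝ (gradient f (x + t • u)) u)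
      (G := fun t => t * G) (G' := fun _ => 1 * G)
      (fun s hs' => hasDerivAt_comp_line h.isOpen h.contDiffOn (hin s (hs s hs')))
      (fun s _ => (hasDerivAt_id s).mul_const _)
      (fun s hs' => by
        rw [one_mul]
        exact hgrad s (hs s hs'))
    simp only [zero_smul, add_zero, zero_mul, sub_zero] at key
    have h1 : t * G ≤ G := mul_le_of_le_one_left hG0 (ht.2.le.trans hT1)
    linarith
  have hne : (𝓝[Ico 0 T] T).NeBot := by
    rw [← mem_closure_iff_nhdsWithin_neBot, closure_Ico hT.ne]
    exact right_mem_Icc.2 hT0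
  have htend : Tendsto (fun t : ℝ => x + t • u) (𝓝[Ico 0 T] T) (𝓝[D] (x + T • u)) :=
    tendsto_nhdsWithin_iff.2 ⟨(hline.tendsto T).mono_left nhdsWithin_le_nhds,
      eventually_nhdsWithin_of_forall hin⟩
  have hcl : x + T • u ∈ closure D :=
    mem_closure_of_tendsto (htend.mono_right nhdsWithin_le_nhds)
      (eventually_nhdsWithin_of_forall hin)
  have hev := ((hb _ hcl hTD).comp htend).eventually_gt_atTop (f x + G)
  obtain ⟨t, ht1, ht2⟩ := (hev.and (eventually_nhdsWithin_of_forall hbd)).exists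
  exact absurd ht2 (not_le.2 ht1)

/-- A gradient bound `|⟨∇f(x), u⟩| ≤ √ν ‖u‖ₓ` forces `⟨∇f(x), y - x⟩ ≤ ν`. -/
theorem inner_gradient_le_of_barrier (h : IsNondegSelfConcordant D f) {ν : ℝ} (hν : 0 < ν)
    (hg : ∀ x ∈ D, ∀ u, inner ℝ (gradient f x) u ≤ √ν * localNorm f x u) {x y : Vec p}
    (hx : x ∈ D) (hy : y ∈ D) : inner ℝ (gradient f x) (y - x) ≤ ν := by
  obtain ⟨u, rfl⟩ : ∃ u, y = x + u := ⟨y - x, by abel⟩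
  rw [add_sub_cancel_left]
  have hseg := fun t ht => h.segment_mem hx hy (t := t) ht
  by_contra! hlt
  have h0 : 0 < inner ℝ (gradient f x) u := hν.trans hlt
  have hder : ∀ t ∈ Icc (0 : ℝ) 1, HasDerivAt (fun s : ℝ => inner ℝ (gradient f (x + s • u)) u)
      (inner ℝ (hess f (x + t • u) u) u) t :=
    fun t ht => hasDerivAt_inner_gradient h.isOpen h.contDiffOn (hseg t ht) u
  have hpos : ∀ t ∈ Icc (0 : ℝ) 1, 0 < inner ℝ (gradient f (x + t • u)) u := by
    intro t ht
    have key := sub_le_sub_of_hasDerivAt_le ht.1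
      (fun s _ => hasDerivAt_const s (0 : ℝ)) (fun s hs => hder s ⟨hs.1, hs.2.trans ht.2⟩)
      (fun s hs => h.inner_hess_nonneg (hseg s ⟨hs.1, hs.2.trans ht.2⟩) u)
    simp only [zero_smul, add_zero, sub_self] at key
    linarith
  -- The slope `φ` satisfies `φ' ≥ φ² / ν`, so `1/φ` falls by at least `1/ν` over unit time.
  -- Starting below `1/ν`, it would become negative.
  have key := sub_le_sub_of_hasDerivAt_le zero_le_one
    (fun t ht => (hder t ht).inv (hpos t ht).ne')
    (G := fun t => t * (- ν⁻¹)) (G' := fun _ => 1 * (- ν⁻¹))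
    (fun t _ => (hasDerivAt_id t).mul_const _)
    (fun t ht => by
      have h1 := hpos t ht
      have h2 := pow_le_pow_left₀ h1.le (hg _ (hseg t ht) u) 2
      rw [mul_pow, Real.sq_sqrt hν.le, h.localNorm_sq (hseg t ht)] at h2
      rw [div_le_iff₀ (by positivity), one_mul, neg_mul, neg_le_neg_iff, inv_mul_le_iff₀ hν]
      exact h2)
  simp only [Pi.inv_apply, one_smul, zero_smul, add_zero, one_mul, zero_mul, sub_zero] at key
  have h1 := inv_pos.2 (hpos 1 ⟨zero_le_one, le_rfl⟩)
  rw [one_smul] at h1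
  have h2 := inv_strictAnti₀ hν hlt
  linarith

/-- The domain of a barrier lies in an ellipsoid of radius `ν + 2√ν` around a critical point. -/
theorem localNorm_sub_center_le (h : IsNondegSelfConcordant D f) {ν : ℝ} (hν : 0 < ν)
    (hg : ∀ x ∈ D, ∀ u, inner ℝ (gradient f x) u ≤ √ν * localNorm f x u) {z y : Vec p}
    (hz : z ∈ D) (hz0 : gradient f z = 0) (hy : y ∈ D) :
    localNorm f z (y - z) ≤ ν + 2 * √ν := by
  obtain ⟨u, rfl⟩ : ∃ u, y = z + u := ⟨y - z, by abel⟩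
  rw [add_sub_cancel_left]
  set r := localNorm f z u with hr
  have hs : 0 < √ν := Real.sqrt_pos.2 hν
  have hs2 : √ν ^ 2 = ν := Real.sq_sqrt hν.le
  by_contra! hlt
  have hrs : √ν < r := by linarith
  have hr0 : 0 < r := hs.trans hrs
  -- The intermediate point is at local distance exactly `√ν` from `z`. Strong monotonicity bounds
  -- the slope `P` there from below, the barrier inequality bounds `(1 - α) * P` by `ν`, and
  -- together they give `r ≤ ν + 2√ν`.
  set α := √ν / r with hα
  have hα0 : 0 < α := by positivity
  have hα1 : α < 1 := (div_lt_one hr0).2 hrs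
  have hαr : α * r = √ν := div_mul_cancel₀ _ hr0.ne'
  have hm := h.segment_mem hz hy ⟨hα0.le, hα1.le⟩
  have h1 := h.le_inner_gradient_sub hz hm
  rw [add_sub_cancel_left, localNorm_smul, abs_of_pos hα0, ← hr, hαr, hz0, sub_zero,
    real_inner_smul_right, div_le_iff₀ (by positivity)] at h1
  have h2 := h.inner_gradient_le_of_barrier hν hg hm hy
  have e : z + u - (z + α • u) = (1 - α) • u := by module
  rw [e, real_inner_smul_right] at h2
  set P := inner ℝ (gradient f (z + α • u)) u
  -- `√ν r ≤ P (1 + √ν)` and `(r - √ν) P ≤ ν r`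
  have h3 : √ν * r ≤ P * (1 + √ν) := by
    have := mul_le_mul_of_nonneg_left h1 hr0.le
    have e : r * (α * P * (1 + √ν)) = √ν * (P * (1 + √ν)) := by rw [← hαr]; ring
    rw [e] at this
    refine le_of_mul_le_mul_left (le_trans (le_of_eq ?_) this) hs
    ring
  have h4 : (r - √ν) * P ≤ ν * r := by
    have := mul_le_mul_of_nonneg_right h2 hr0.le
    refine le_trans (le_of_eq ?_) this
    rw [← hαr]
    ring
  have h5 : √ν * r * (r - √ν) ≤ ν * r * (1 + √ν) := by
    nlinarith [mul_le_mul_of_nonneg_right h3 (sub_nonneg.2 hrs.le),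
      mul_le_mul_of_nonneg_right h4 (by positivity : 0 ≤ 1 + √ν)]
  have h6 : (√ν * r) * (r - √ν) ≤ (√ν * r) * (√ν * (1 + √ν)) := by
    refine h5.trans (le_of_eq ?_)
    nth_rw 1 [← hs2]
    ring
  have h7 := le_of_mul_le_mul_left h6 (by positivity)
  nlinarith

/-- If `‖u‖_a < 1`, the Dikin ellipsoid puts `a + u` and `a - u` in `D`, hence within `ν + 2√ν` of
the center `z`; the triangle inequality bounds half their difference. Homogeneity does the rest. -/
theorem localNorm_center_le (h : IsNondegSelfConcordant D f) {ν : ℝ} (hν : 0 < ν)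
    (hb : ∀ y ∈ closure D, y ∉ D → Tendsto f (𝓝[D] y) atTop)
    (hg : ∀ x ∈ D, ∀ u, inner ℝ (gradient f x) u ≤ √ν * localNorm f x u) {z a : Vec p}
    (hz : z ∈ D) (hz0 : gradient f z = 0) (ha : a ∈ D) (u : Vec p) :
    localNorm f z u ≤ (ν + 2 * √ν) * localNorm f a u := by
  have hs : 0 < √ν := Real.sqrt_pos.2 hν
  have unit : ∀ u, localNorm f a u < 1 → localNorm f z u ≤ ν + 2 * √ν := by
    intro u hu
    have h1 := h.localNorm_sub_center_le hν hg hz hz0 (h.dikin_mem hb ha hu)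
    have h2 := h.localNorm_sub_center_le hν hg hz hz0
      (h.dikin_mem hb ha (u := -u) (by rwa [localNorm_neg]))
    have h3 := h.localNorm_add_le hz (a + u - z) (-(a + -u - z))
    have e : a + u - z + -(a + -u - z) = (2 : ℝ) • u := by module
    rw [e, localNorm_smul, localNorm_neg, abs_of_pos two_pos] at h3
    linarith
  have h1 : ∀ c, localNorm f a u < c → localNorm f z u ≤ (ν + 2 * √ν) * c := by
    intro c hc
    have hc0 : 0 < c := (localNorm_nonneg _ _ _).trans_lt hc
    have := unit (c⁻¹ • u) (by
      rw [localNorm_smul, abs_inv, abs_of_pos hc0, inv_mul_lt_iff₀ hc0, mul_one]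
      exact hc)
    rw [localNorm_smul, abs_inv, abs_of_pos hc0, inv_mul_le_iff₀ hc0] at this
    linarith
  have hκ : 0 < ν + 2 * √ν := by positivity
  rw [← div_le_iff₀' hκ]
  -- Only the open ellipsoid lies in `D`, so the scaling factor must exceed the norm and the bound
  -- is reached in the limit.
  refine le_of_forall_gt_imp_ge_of_dense fun c hc => ?_
  rw [div_le_iff₀' hκ]
  exact h1 c hc

/-- Cauchy–Schwarz for the local norm and its dual. -/
theorem inner_le_dualLocalNorm (h : IsNondegSelfConcordant D f) {x : Vec p} (hx : x ∈ D)
    (v u : Vec p) : inner ℝ v u ≤ dualLocalNorm f x v * localNorm f x u := by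
  have hinj : Function.Injective (hess f x) := by
    rw [injective_iff_map_eq_zero]
    intro w hw
    by_contra hne
    have := h.pos x hx w hne
    simp [hw] at this
  let e : Vec p ≃L[ℝ] Vec p :=
    (LinearEquiv.ofInjectiveEndo (hess f x).toLinearMap hinj).toContinuousLinearEquiv
  have he : (e : Vec p →L[ℝ] Vec p) = hess f x := by
    ext w
    rfl
  have hinv : hess f x ((hess f x).inverse v) = v := by
    rw [← he, ContinuousLinearMap.inverse_equiv]
    simp
  set w := (hess f x).inverse v with hw
  have h1 := (le_abs_self _).trans (h.abs_inner_hess_le hx w u)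
  rw [hinv] at h1
  have e2 : dualLocalNorm f x v = localNorm f x w := by
    rw [dualLocalNorm, localNorm, ← hw, hinv, real_inner_comm]
  rwa [e2]

end IsNondegSelfConcordant

/-! ### From the barrier hypotheses to the local inequalities -/

theorem IsSelfConcordantBarrier.isNondegSelfConcordant {X : Set (Vec p)} {f : Vec p → ℝ} {ν : ℝ}
    (hf : IsSelfConcordantBarrier X f ν)
    (hpd : ∀ x ∈ interior X, ∀ u : Vec p, u ≠ 0 → 0 < inner ℝ (hess f x u) u) :
    IsNondegSelfConcordant (interior X) f where
  isOpen := isOpen_interior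
  convex := hf.convex.interior
  contDiffOn := hf.selfConcordant.contDiffOn
  pos := hpd
  third_diag x hx u := by
    refine (hf.selfConcordant.third_le x hx u).trans (le_of_eq ?_)
    have h0 : 0 ≤ inner ℝ (hess f x u) u := by
      rcases eq_or_ne u 0 with rfl | hu
      · simp
      · exact (hpd x hx u hu).le
    rw [localNorm, Real.sqrt_eq_rpow, ← Real.rpow_natCast, ← Real.rpow_mul h0]
    norm_num

theorem IsSelfConcordantBarrier.tendsto_atTop {X : Set (Vec p)} {f : Vec p → ℝ} {ν : ℝ}
    (hf : IsSelfConcordantBarrier X f ν) :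
    ∀ y ∈ closure (interior X), y ∉ interior X → Tendsto f (𝓝[interior X] y) atTop :=
  fun y hy hy' => hf.tendsto_boundary y ⟨closure_mono interior_subset hy, hy'⟩

theorem IsSelfConcordantBarrier.inner_gradient_le {X : Set (Vec p)} {f : Vec p → ℝ} {ν : ℝ}
    (hf : IsSelfConcordantBarrier X f ν)
    (hpd : ∀ x ∈ interior X, ∀ u : Vec p, u ≠ 0 → 0 < inner ℝ (hess f x u) u) :
    ∀ x ∈ interior X, ∀ u, inner ℝ (gradient f x) u ≤ √ν * localNorm f x u := by
  intro x hx u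
  rcases eq_or_ne u 0 with rfl | hu
  · simp [localNorm_zero]
  have hn := (hf.isNondegSelfConcordant hpd).localNorm_pos hx hu
  have hν : 0 ≤ ν := zero_le_one.trans hf.one_le
  -- This multiple of `u` maximizes the quadratic expression along its line; its maximal value is
  -- `⟨∇f(x), u⟩² / ‖u‖ₓ²`.
  have h1 := hf.sup_le x hx ((inner ℝ (gradient f x) u / localNorm f x u ^ 2) • u)
  rw [localNorm_smul, mul_pow, sq_abs, real_inner_smul_right] at h1
  refine abs_le_of_sq_le_sq' ?_ (by positivity) |>.2
  rw [mul_pow, Real.sq_sqrt hν]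
  rw [← div_le_iff₀ (by positivity)]
  refine le_trans (le_of_eq ?_) h1
  field_simp
  ring

theorem theta_nonneg (X : Set (Vec p)) (f : Vec p → ℝ) {ν : ℝ} (hν : 0 ≤ ν) :
    0 ≤ theta X f ν := by
  unfold theta
  split_ifs <;> positivity

theorem cbar_nonneg (X : Set (Vec p)) (f : Vec p → ℝ) {ν : ℝ} (hν : 0 ≤ ν) (ξ : Vec p) :
    0 ≤ cbar X f ν ξ := by
  unfold cbar
  split_ifs
  · exact mul_nonneg (theta_nonneg X f hν) (Real.sqrt_nonneg _)
  · exact le_rfl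

theorem isArgmin_argmin {Φ : Vec p → EReal} (h : ∃ x, IsArgmin Φ x) : IsArgmin Φ (argmin Φ) := by
  unfold argmin
  rw [dif_pos h]
  exact h.choose_spec

theorem IsAnalyticCenter.mem_and_le {X : Set (Vec p)} {f : Vec p → ℝ} {z : Vec p}
    (hz : IsAnalyticCenter X f z) : z ∈ interior X ∧ ∀ y ∈ interior X, f z ≤ f y := by
  obtain ⟨h1, h2⟩ := hz
  have hzX : z ∈ interior X := by
    by_contra hne
    exact h1 (if_neg hne)
  refine ⟨hzX, fun y hy => ?_⟩
  have := h2 y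
  simp only [extendTop, if_pos hzX, if_pos hy] at this
  exact_mod_cast this

/-- A logarithmically homogeneous barrier is unbounded below, hence has no analytic center. -/
theorem IsAnalyticCenter.not_isLogHomogeneous {X : Set (Vec p)} {f : Vec p → ℝ} {z : Vec p} {ν : ℝ}
    (hν : 0 < ν) (hz : IsAnalyticCenter X f z) : ¬ IsLogHomogeneous X f ν := by
  intro hl
  obtain ⟨h1, h2⟩ := hz.mem_and_le
  obtain ⟨h3, h4⟩ := hl z h1 2 two_pos
  have := h2 _ h3
  have := mul_pos hν (Real.log_pos one_lt_two)
  linarith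

/-- The linear functional `ξ + ∇f(a)` is bounded by `√ν + c̄₀` in the local norm at `a`. -/
theorem inner_add_gradient_le {X : Set (Vec p)} {f : Vec p → ℝ} {ν : ℝ}
    (hf : IsSelfConcordantBarrier X f ν)
    (hpd : ∀ x ∈ interior X, ∀ u : Vec p, u ≠ 0 → 0 < inner ℝ (hess f x u) u) {ξ : Vec p}
    (hcenter : (∃ z, IsAnalyticCenter X f z) ∨ ξ = 0) {a : Vec p} (ha : a ∈ interior X)
    (u : Vec p) :
    inner ℝ (ξ + gradient f a) u ≤ (√ν + cbar X f ν ξ) * localNorm f a u := by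
  have h := hf.isNondegSelfConcordant hpd
  have hν : 0 < ν := zero_lt_one.trans_le hf.one_le
  have hgr := hf.inner_gradient_le hpd
  have h1 := hgr a ha u
  have hn := localNorm_nonneg f a u
  suffices h2 : inner ℝ ξ u ≤ cbar X f ν ξ * localNorm f a u by
    rw [inner_add_left]
    linarith
  by_cases hξ : ξ = 0
  · rw [hξ, inner_zero_left]
    exact mul_nonneg (cbar_nonneg X f hν.le _) hn
  have hex := hcenter.resolve_right hξ
  have hz : IsAnalyticCenter X f (argmin (extendTop X f)) := isArgmin_argmin hex
  -- Since a center exists, the barrier is not logarithmically homogeneous, so `theta` is the factor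
  -- `ν + 2√ν` of the norm comparison.
  rw [cbar, if_pos hex, theta, if_neg (hz.not_isLogHomogeneous hν)]
  generalize argmin (extendTop X f) = z at hz
  obtain ⟨hz1, hz2⟩ := hz.mem_and_le
  have h3 := h.inner_le_dualLocalNorm hz1 ξ u
  have h4 := h.localNorm_center_le hν hf.tendsto_atTop hgr hz1 (h.gradient_eq_zero hz1 hz2) ha u
  refine h3.trans ((mul_le_mul_of_nonneg_left h4 (Real.sqrt_nonneg _)).trans (le_of_eq ?_))
  simp only [dualLocalNorm]
  ring

/-! ### Optimality conditions -/

theorem IsProperClosedConvex.coe_toReal {g : Vec p → EReal} (hg : IsProperClosedConvex g)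
    {y : Vec p} (hy : g y ≠ ⊤) : ((g y).toReal : EReal) = g y := EReal.coe_toReal hy (hg.ne_bot y)

theorem IsProperClosedConvex.le_segment {g : Vec p → EReal} (hg : IsProperClosedConvex g)
    {a y : Vec p} (ha : g a ≠ ⊤) (hy : g y ≠ ⊤) {s : ℝ} (hs : s ∈ Icc (0 : ℝ) 1) :
    g (a + s • (y - a)) ≠ ⊤ ∧
      (g (a + s • (y - a))).toReal ≤ (g a).toReal + s * ((g y).toReal - (g a).toReal) := by
  have h1 : (a, (g a).toReal) ∈ {q : Vec p × ℝ | g q.1 ≤ (q.2 : EReal)} :=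
    (hg.coe_toReal ha).ge
  have h2 : (y, (g y).toReal) ∈ {q : Vec p × ℝ | g q.1 ≤ (q.2 : EReal)} :=
    (hg.coe_toReal hy).ge
  have h3 : g (a + s • (y - a)) ≤
      (((g a).toReal + s * ((g y).toReal - (g a).toReal) : ℝ) : EReal) :=
    hg.convex_epigraph.add_smul_sub_mem h1 h2 hs
  have h4 : g (a + s • (y - a)) ≠ ⊤ := (h3.trans_lt (EReal.coe_lt_top _)).ne
  refine ⟨h4, ?_⟩
  rw [← hg.coe_toReal h4] at h3
  exact_mod_cast h3

/-- First order optimality condition for the sum of a differentiable function and a convex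
extended-valued function. -/
theorem IsProperClosedConvex.toReal_le_of_isLocalMin {g : Vec p → EReal}
    (hg : IsProperClosedConvex g) {h : Vec p → ℝ} {a d : Vec p} (hd : HasGradientAt h d a)
    (ha : g a ≠ ⊤)
    (hmin : ∀ᶠ y in 𝓝 a, g y ≠ ⊤ → h a + (g a).toReal ≤ h y + (g y).toReal) {y : Vec p}
    (hy : g y ≠ ⊤) : (g a).toReal ≤ (g y).toReal + inner ℝ d (y - a) := by
  have hline : Tendsto (fun s : ℝ => a + s • (y - a)) (𝓝 0) (𝓝 a) := by
    have : Continuous (fun s : ℝ => a + s • (y - a)) := by fun_prop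
    simpa using this.tendsto 0
  have hder : HasDerivAt
      (fun s : ℝ => h (a + s • (y - a)) + s * ((g y).toReal - (g a).toReal))
      (inner ℝ d (y - a) + 1 * ((g y).toReal - (g a).toReal)) 0 := by
    have h1 : HasFDerivAt h (InnerProductSpace.toDual ℝ (Vec p) d) (a + (0 : ℝ) • (y - a)) := by
      simpa using hd.hasFDerivAt
    have h2 := h1.comp_hasDerivAt 0 (hasDerivAt_line a (y - a) 0)
    exact HasDerivAt.add (by simpa [Function.comp_def] using h2) ((hasDerivAt_id 0).mul_const _)
  have hslope := hder.tendsto_slope_zero_right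
  have hev : ∀ᶠ s : ℝ in 𝓝[>] 0, 0 ≤ s⁻¹ • ((h (a + (0 + s) • (y - a)) +
      (0 + s) * ((g y).toReal - (g a).toReal)) -
        (h (a + (0 : ℝ) • (y - a)) + 0 * ((g y).toReal - (g a).toReal))) := by
    filter_upwards [(hline.eventually hmin).filter_mono nhdsWithin_le_nhds,
      Ioc_mem_nhdsGT (zero_lt_one' ℝ)] with s hs hs1
    obtain ⟨h1, h2⟩ := hg.le_segment ha hy ⟨hs1.1.le, hs1.2⟩
    have h3 := hs h1
    refine smul_nonneg (inv_nonneg.2 hs1.1.le) ?_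
    simp only [zero_add, zero_smul, add_zero, zero_mul]
    linarith
  have := ge_of_tendsto hslope hev
  linarith

/-- Minimizers of `h + g`, where `dom h = int X`, in terms of real values. -/
theorem isArgmin_extendTop_add_iff {X : Set (Vec p)} {g : Vec p → EReal}
    (hg : IsProperClosedConvex g) {h : Vec p → ℝ} {a : Vec p} :
    IsArgmin (fun x => extendTop X h x + g x) a ↔ a ∈ interior X ∧ g a ≠ ⊤ ∧
      ∀ y ∈ interior X, g y ≠ ⊤ → h a + (g a).toReal ≤ h y + (g y).toReal := by
  have hval : ∀ y ∈ interior X, g y ≠ ⊤ →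
      extendTop X h y + g y = ((h y + (g y).toReal : ℝ) : EReal) := by
    intro y hy hgy
    rw [extendTop, if_pos hy, EReal.coe_add, hg.coe_toReal hgy]
  have htop : ∀ y, extendTop X h y + g y ≠ ⊤ → y ∈ interior X ∧ g y ≠ ⊤ := by
    intro y hy
    constructor
    · by_contra hne
      rw [extendTop, if_neg hne, EReal.top_add_of_ne_bot (hg.ne_bot y)] at hy
      exact hy rfl
    · intro hgy
      rw [hgy, EReal.add_top_of_ne_bot] at hy
      · exact hy rfl
      · unfold extendTop
        split_ifs <;> simp
  constructor
  · rintro ⟨h1, h2⟩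
    obtain ⟨ha, hga⟩ := htop a h1
    refine ⟨ha, hga, fun y hy hgy => ?_⟩
    have := h2 y
    simp only [hval a ha hga, hval y hy hgy] at this
    exact_mod_cast this
  · rintro ⟨ha, hga, h2⟩
    refine ⟨?_, fun y => ?_⟩
    · simp only [hval a ha hga]
      exact EReal.coe_ne_top _
    · simp only [hval a ha hga]
      by_cases hy : extendTop X h y + g y = ⊤
      · rw [hy]
        exact le_top
      · obtain ⟨h3, h4⟩ := htop y hy
        rw [hval y h3 h4]
        exact_mod_cast h2 y h3 h4

theorem isArgmin_objective_iff {X : Set (Vec p)} {f : Vec p → ℝ} {g : Vec p → EReal} {ξ a : Vec p} :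
    IsArgmin (objective X f g) a ↔ IsArgmin (paramObjective X f g ξ 1) a := by
  have : objective X f g = paramObjective X f g ξ 1 := by
    funext x
    simp [objective, paramObjective, extendTop]
  rw [this]

/-- The data common to all composite problems `F_τ`. -/
structure IsCompositeProblem (X : Set (Vec p)) (f : Vec p → ℝ) (g : Vec p → EReal) (x₀ ξ : Vec p)
    (s : ℝ) : Prop where
  selfConcordant : IsNondegSelfConcordant (interior X) f
  tendsto_atTop : ∀ y ∈ closure (interior X), y ∉ interior X → Tendsto f (𝓝[interior X] y) atTop
  proper : IsProperClosedConvex g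
  mem : x₀ ∈ interior X
  subgradient : IsSubgradient g x₀ ξ
  pos : 0 < s
  inner_le : ∀ a ∈ interior X, ∀ u, inner ℝ (ξ + gradient f a) u ≤ s * localNorm f a u

namespace IsCompositeProblem

variable {X : Set (Vec p)} {f : Vec p → ℝ} {g : Vec p → EReal} {x₀ ξ : Vec p} {s : ℝ}

theorem isArgmin_iff (P : IsCompositeProblem X f g x₀ ξ s) {τ : ℝ} {a : Vec p} :
    IsArgmin (paramObjective X f g ξ τ) a ↔ a ∈ interior X ∧ g a ≠ ⊤ ∧
      ∀ y ∈ interior X, g y ≠ ⊤ → τ * f a - (1 - τ) * inner ℝ ξ a + (g a).toReal ≤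
        τ * f y - (1 - τ) * inner ℝ ξ y + (g y).toReal :=
  isArgmin_extendTop_add_iff P.proper

/-- Optimality condition for `x*_τ`. -/
theorem toReal_le (P : IsCompositeProblem X f g x₀ ξ s) {τ : ℝ} {a : Vec p}
    (ha : IsArgmin (paramObjective X f g ξ τ) a) {y : Vec p} (hy : g y ≠ ⊤) :
    (g a).toReal ≤ (g y).toReal + inner ℝ (τ • gradient f a - (1 - τ) • ξ) (y - a) := by
  obtain ⟨h1, h2, h3⟩ := P.isArgmin_iff.1 ha
  have hd : HasGradientAt (fun z => τ * f z - (1 - τ) * inner ℝ ξ z)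
      (τ • gradient f a - (1 - τ) • ξ) a := by
    have e1 := (hasGradientAt_of_mem P.selfConcordant.isOpen P.selfConcordant.contDiffOn
      h1).hasFDerivAt.const_mul τ
    have e2 := ((innerSL ℝ ξ).hasFDerivAt (x := a)).const_mul (1 - τ)
    rw [hasGradientAt_iff_hasFDerivAt]
    refine (e1.sub e2).congr_fderiv ?_
    ext v
    simp
  exact P.proper.toReal_le_of_isLocalMin hd h2
    (Filter.mem_of_superset (isOpen_interior.mem_nhds h1) fun y hy hgy => h3 y hy hgy) hy

/-- Each optimality condition tested at the other minimizer; adding them cancels `g`, which is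
monotonicity of its subdifferential. -/
theorem inner_nonneg (P : IsCompositeProblem X f g x₀ ξ s) {τ τ' : ℝ} {a b : Vec p}
    (ha : IsArgmin (paramObjective X f g ξ τ) a) (hb : IsArgmin (paramObjective X f g ξ τ') b) :
    0 ≤ inner ℝ (τ • gradient f a - (1 - τ) • ξ) (b - a)
      - inner ℝ (τ' • gradient f b - (1 - τ') • ξ) (b - a) := by
  have h1 := P.toReal_le ha (P.isArgmin_iff.1 hb).2.1
  have h2 := P.toReal_le hb (P.isArgmin_iff.1 ha).2.1
  rw [← neg_sub b a, inner_neg_right] at h2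
  linarith

/-- Motion of the solution path, measured at the starting point. -/
theorem localNorm_sub_le_left (P : IsCompositeProblem X f g x₀ ξ s) {τ τ' : ℝ} (hτ : 0 < τ)
    (hττ' : τ ≤ τ') {a b : Vec p}
    (ha : IsArgmin (paramObjective X f g ξ τ) a) (hb : IsArgmin (paramObjective X f g ξ τ') b) :
    τ' * localNorm f a (b - a) ≤ (τ' - τ) * s * (1 + localNorm f a (b - a)) := by
  have haD := (P.isArgmin_iff.1 ha).1
  have hbD := (P.isArgmin_iff.1 hb).1
  have h0 := P.inner_nonneg ha hb
  have h1 := P.selfConcordant.le_inner_gradient_sub haD hbD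
  have h2 := P.inner_le a haD (a - b)
  rw [localNorm_sub_rev] at h2
  rcases (localNorm_nonneg f a (b - a)).eq_or_lt with h | h
  · rw [← h]
    have := mul_nonneg (sub_nonneg.2 hττ') P.pos.le
    linarith
  set r := localNorm f a (b - a)
  have hτ' : 0 < τ' := hτ.trans_le hττ'
  rw [← neg_sub b a, inner_neg_right] at h2
  simp only [inner_sub_left, inner_add_left, real_inner_smul_left] at h0 h1 h2
  have h3 := mul_le_mul_of_nonneg_left h1 hτ'.le
  have h4 := mul_le_mul_of_nonneg_left h2 (sub_nonneg.2 hττ')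
  -- The difference of the two gradients splits as `(τ - τ')(ξ + ∇f(a)) - τ'(∇f(b) - ∇f(a))`: the
  -- first part has dual norm at most `(τ' - τ) s`, the second is strongly monotone.
  have h5 : τ' * (r ^ 2 / (1 + r)) ≤ (τ' - τ) * (s * r) := by linarith
  have h6 : r * (τ' * r) ≤ r * ((τ' - τ) * s * (1 + r)) := by
    rw [mul_div_assoc', div_le_iff₀ (by positivity)] at h5
    linarith
  exact le_of_mul_le_mul_left h6 h

/-- Motion of the solution path, measured at the end point. -/
theorem localNorm_sub_le_right (P : IsCompositeProblem X f g x₀ ξ s) {τ τ' : ℝ} (hτ : 0 < τ)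
    (hττ' : τ ≤ τ') {a b : Vec p}
    (ha : IsArgmin (paramObjective X f g ξ τ) a) (hb : IsArgmin (paramObjective X f g ξ τ') b) :
    τ * localNorm f b (a - b) ≤ (τ' - τ) * s * (1 + localNorm f b (a - b)) := by
  have haD := (P.isArgmin_iff.1 ha).1
  have hbD := (P.isArgmin_iff.1 hb).1
  have h0 := P.inner_nonneg ha hb
  have h1 := P.selfConcordant.le_inner_gradient_sub hbD haD
  have h2 := P.inner_le b hbD (a - b)
  rcases (localNorm_nonneg f b (a - b)).eq_or_lt with h | h
  · rw [← h]
    have := mul_nonneg (sub_nonneg.2 hττ') P.pos.le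
    linarith
  set r := localNorm f b (a - b)
  rw [← neg_sub a b, inner_neg_right, inner_neg_right] at h0
  simp only [inner_sub_left, inner_add_left, real_inner_smul_left] at h0 h1 h2
  have h3 := mul_le_mul_of_nonneg_left h1 hτ.le
  have h4 := mul_le_mul_of_nonneg_left h2 (sub_nonneg.2 hττ')
  -- The same difference, split at `b`: `τ(∇f(a) - ∇f(b)) - (τ' - τ)(ξ + ∇f(b))`. The monotone part
  -- now carries `τ`.
  have h5 : τ * (r ^ 2 / (1 + r)) ≤ (τ' - τ) * (s * r) := by linarith
  have h6 : r * (τ * r) ≤ r * ((τ' - τ) * s * (1 + r)) := by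
    rw [mul_div_assoc', div_le_iff₀ (by positivity)] at h5
    linarith
  exact le_of_mul_le_mul_left h6 h

theorem isArgmin_unique (P : IsCompositeProblem X f g x₀ ξ s) {τ : ℝ} (hτ : 0 < τ) {a b : Vec p}
    (ha : IsArgmin (paramObjective X f g ξ τ) a) (hb : IsArgmin (paramObjective X f g ξ τ) b) :
    a = b := by
  have h1 := P.localNorm_sub_le_left hτ le_rfl ha hb
  rw [sub_self, zero_mul, zero_mul] at h1
  have h2 : localNorm f a (b - a) = 0 :=
    le_antisymm (nonpos_of_mul_nonpos_right h1 hτ) (localNorm_nonneg _ _ _)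
  exact (sub_eq_zero.1 (P.selfConcordant.localNorm_eq_zero (P.isArgmin_iff.1 ha).1 h2)).symm

end IsCompositeProblem

/-! ### Existence of the solution path -/

theorem IsNondegSelfConcordant.exists_mul_norm_le {D : Set (Vec p)} {f : Vec p → ℝ}
    (h : IsNondegSelfConcordant D f) {x : Vec p} (hx : x ∈ D) :
    ∃ c, 0 < c ∧ ∀ u, c * ‖u‖ ≤ localNorm f x u := by
  by_cases hne : (Metric.sphere (0 : Vec p) 1).Nonempty
  · obtain ⟨w, hw, hmin⟩ := (isCompact_sphere (0 : Vec p) 1).exists_isMinOn hne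
      (f := localNorm f x) (by unfold localNorm; fun_prop)
    have hw1 : ‖w‖ = 1 := by simpa using hw
    refine ⟨localNorm f x w, h.localNorm_pos hx (by rintro rfl; simp at hw1), fun u => ?_⟩
    rcases eq_or_ne u 0 with rfl | hu
    · simp [localNorm_zero]
    have hu' : 0 < ‖u‖ := norm_pos_iff.2 hu
    have h1 : localNorm f x w ≤ localNorm f x (‖u‖⁻¹ • u) :=
      hmin (by simp [norm_smul, hu'.ne'])
    rw [localNorm_smul, abs_inv, abs_of_pos hu', ← div_eq_inv_mul, le_div_iff₀ hu'] at h1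
    exact h1
  · refine ⟨1, one_pos, fun u => ?_⟩
    rcases eq_or_ne u 0 with rfl | hu
    · simp [localNorm_zero]
    · exact absurd ⟨‖u‖⁻¹ • u, by simp [norm_smul, hu]⟩ hne

/-- Blow-up at the boundary is what keeps the sublevel sets closed. Away from the closure of `int X`
the filter is trivial, so the hypothesis costs nothing there. -/
theorem lowerSemicontinuous_extendTop {X : Set (Vec p)} {h : Vec p → ℝ}
    (hc : ContinuousOn h (interior X))
    (hb : ∀ y ∉ interior X, Tendsto h (𝓝[interior X] y) atTop) :
    LowerSemicontinuous (extendTop X h) := by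
  intro x c hxc
  by_cases hx : x ∈ interior X
  · have hat : ContinuousAt h x := hc.continuousAt (isOpen_interior.mem_nhds hx)
    have h1 : ContinuousAt (fun y => (h y : EReal)) x :=
      continuous_coe_real_ereal.continuousAt.comp hat
    simp only [extendTop, if_pos hx] at hxc
    filter_upwards [h1.eventually (lt_mem_nhds hxc), isOpen_interior.mem_nhds hx] with y hy hyX
    simpa only [extendTop, if_pos hyX] using hy
  · simp only [extendTop, if_neg hx] at hxc
    obtain ⟨m, hcm⟩ : ∃ m : ℝ, c ≤ (m : EReal) := by
      induction c with
      | bot => exact ⟨0, bot_le⟩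
      | coe c => exact ⟨c, le_rfl⟩
      | top => exact absurd hxc (lt_irrefl _)
    have h1 := eventually_nhdsWithin_iff.1 ((hb x hx).eventually_gt_atTop m)
    filter_upwards [h1] with y hy
    by_cases hyX : y ∈ interior X
    · simp only [extendTop, if_pos hyX]
      exact hcm.trans_lt (by exact_mod_cast hy hyX)
    · simpa only [extendTop, if_neg hyX] using hxc

namespace IsCompositeProblem

variable {X : Set (Vec p)} {f : Vec p → ℝ} {g : Vec p → EReal} {x₀ ξ : Vec p} {s : ℝ}

theorem lowerSemicontinuous (P : IsCompositeProblem X f g x₀ ξ s) {τ : ℝ} (hτ : 0 < τ) :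
    LowerSemicontinuous (paramObjective X f g ξ τ) := by
  have hlin : Continuous (fun z : Vec p => (1 - τ) * inner ℝ ξ z) := by fun_prop
  have h1 : LowerSemicontinuous
      (extendTop X (fun z => τ * f z - (1 - τ) * inner ℝ ξ z)) := by
    refine lowerSemicontinuous_extendTop ?_ ?_
    · exact (continuousOn_const.mul P.selfConcordant.contDiffOn.continuousOn).sub hlin.continuousOn
    · intro y hy
      by_cases hyc : y ∈ closure (interior X)
      · have h2 := (P.tendsto_atTop y hyc hy).const_mul_atTop hτ
        have h3 : Tendsto (fun z : Vec p => -((1 - τ) * inner ℝ ξ z)) (𝓝[interior X] y)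
            (𝓝 (-((1 - τ) * inner ℝ ξ y))) := (hlin.neg.tendsto y).mono_left nhdsWithin_le_nhds
        simpa only [sub_eq_add_neg] using h2.atTop_add h3
      · rw [notMem_closure_iff_nhdsWithin_eq_bot.1 hyc]
        exact tendsto_bot
  refine LowerSemicontinuous.add' h1 P.proper.closed fun x => ?_
  refine EReal.continuousAt_add (Or.inr (P.proper.ne_bot x)) (Or.inl ?_)
  simp only [extendTop]
  split_ifs
  · exact EReal.coe_ne_bot _
  · exact top_ne_bot

/-- Coercivity of `F` around its minimizer. -/
theorem objective_growth (P : IsCompositeProblem X f g x₀ ξ s) {xs : Vec p}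
    (hxs : IsArgmin (paramObjective X f g ξ 1) xs) {y : Vec p} (hy : y ∈ interior X)
    (hgy : g y ≠ ⊤) :
    f xs + (g xs).toReal + (localNorm f xs (y - xs) / 2 - 1) ≤ f y + (g y).toReal := by
  have hD := (P.isArgmin_iff.1 hxs).1
  have h1 := P.toReal_le hxs hgy
  simp only [one_smul, sub_self, zero_smul, sub_zero] at h1
  have h2 := P.selfConcordant.add_inner_gradient_add_le hD hy
  have h3 := localNorm_nonneg f xs (y - xs)
  have h4 : localNorm f xs (y - xs) / 2 - 1 ≤
      (localNorm f xs (y - xs) / 2) ^ 2 / (1 + localNorm f xs (y - xs) / 2) := by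
    rw [le_div_iff₀ (by positivity)]
    linarith
  linarith

/-- Here `F_τ = τ F + (1 - τ)(g - ⟨ξ, ·⟩)`: the first term grows at least linearly away from the
minimizer `xs` of `F`, and the second is minimized at `x₀` because `ξ ∈ ∂g(x₀)`. Minimizing over a
large ball therefore suffices. -/
theorem exists_isArgmin (P : IsCompositeProblem X f g x₀ ξ s) {xs : Vec p}
    (hxs : IsArgmin (paramObjective X f g ξ 1) xs) {τ : ℝ} (hτ : 0 < τ) (hτ1 : τ ≤ 1) :
    ∃ a, IsArgmin (paramObjective X f g ξ τ) a := by
  obtain ⟨hD, hgs, -⟩ := P.isArgmin_iff.1 hxs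
  obtain ⟨c, hc, hcn⟩ := P.selfConcordant.exists_mul_norm_le hD
  obtain ⟨hg0, hsub⟩ := P.subgradient
  -- `K` is the excess of `(1 - τ)(g - ⟨ξ, ·⟩)` at `xs` over its minimum; `R` is the radius beyond
  -- which `τ` times the growth of `F` outweighs it.
  obtain ⟨K, hK⟩ : ∃ K, K = (1 - τ) * ((g xs).toReal - inner ℝ ξ xs - (g x₀).toReal
    + inner ℝ ξ x₀) := ⟨_, rfl⟩
  obtain ⟨R, hR⟩ : ∃ R, R = 2 * (|K| / τ + 1) / c := ⟨_, rfl⟩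
  have hR0 : 0 ≤ R := by rw [hR]; positivity
  obtain ⟨a, haR, hamin⟩ := ((P.lowerSemicontinuous hτ).lowerSemicontinuousOn
    (Metric.closedBall xs R)).exists_isMinOn ⟨xs, Metric.mem_closedBall_self hR0⟩
    (isCompact_closedBall xs R)
  have hle : ∀ y, paramObjective X f g ξ τ a ≤ paramObjective X f g ξ τ y := by
    intro y
    by_cases hyR : y ∈ Metric.closedBall xs R
    · exact hamin hyR
    refine (hamin (Metric.mem_closedBall_self hR0) :
      paramObjective X f g ξ τ a ≤ paramObjective X f g ξ τ xs).trans ?_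
    by_cases hy : y ∈ interior X
    swap
    · rw [paramObjective, paramObjective, extendTop, extendTop, if_neg hy,
        EReal.top_add_of_ne_bot (P.proper.ne_bot y)]
      exact le_top
    by_cases hgy : g y = ⊤
    · simp only [paramObjective, extendTop, if_pos hy, hgy]
      rw [EReal.coe_add_top]
      exact le_top
    simp only [paramObjective, extendTop, if_pos hy, if_pos hD]
    rw [← P.proper.coe_toReal hgy, ← P.proper.coe_toReal hgs]
    norm_cast
    have h1 := P.objective_growth hxs hy hgy
    have h2 := hsub y
    rw [← P.proper.coe_toReal hgy, ← P.proper.coe_toReal hg0] at h2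
    norm_cast at h2
    rw [inner_sub_right] at h2
    have h3 : R < ‖y - xs‖ := by simpa [dist_eq_norm] using hyR
    have h4 : 2 * (|K| / τ + 1) ≤ localNorm f xs (y - xs) := by
      refine le_trans ?_ (hcn _)
      have := mul_le_mul_of_nonneg_left h3.le hc.le
      rwa [hR, mul_div_cancel₀ _ hc.ne'] at this
    have h5 : |K| ≤ τ * (localNorm f xs (y - xs) / 2 - 1) := by
      rw [← div_le_iff₀' hτ]
      linarith
    have h6 := mul_le_mul_of_nonneg_left h1 hτ.le
    have h7 := mul_le_mul_of_nonneg_left h2 (sub_nonneg.2 hτ1)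
    have h8 := le_abs_self K
    rw [hK] at h8 h5
    linarith
  refine ⟨a, fun htop => ?_, hle⟩
  have h1 := hle xs
  rw [htop, top_le_iff, paramObjective, extendTop, if_pos hD, ← P.proper.coe_toReal hgs,
    ← EReal.coe_add] at h1
  exact EReal.coe_ne_top _ h1

end IsCompositeProblem

/-! ### The inexact proximal-Newton step -/

/-- The smooth part of the subproblem. -/
def quadModel (f : Vec p → ℝ) (ξ : Vec p) (τ : ℝ) (x z : Vec p) : ℝ :=
  inner ℝ (gradient f x - (1 / τ - 1) • ξ) (z - x) + 1 / 2 * inner ℝ (hess f x (z - x)) (z - x)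

theorem quadModel_add {D : Set (Vec p)} {f : Vec p → ℝ} (h : IsNondegSelfConcordant D f)
    {x : Vec p} (hx : x ∈ D) (ξ : Vec p) (τ : ℝ) (z w : Vec p) :
    quadModel f ξ τ x (z + w) = quadModel f ξ τ x z +
      inner ℝ (gradient f x - (1 / τ - 1) • ξ + hess f x (z - x)) w
        + 1 / 2 * localNorm f x w ^ 2 := by
  have e : z + w - x = (z - x) + w := by abel
  rw [quadModel, quadModel, e, map_add, h.localNorm_sq hx]
  simp only [inner_add_left, inner_add_right, h.hess_comm hx w (z - x)]
  ring

theorem hasGradientAt_quadModel {D : Set (Vec p)} {f : Vec p → ℝ} (h : IsNondegSelfConcordant D f)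
    {x : Vec p} (hx : x ∈ D) (ξ : Vec p) (τ : ℝ) (z : Vec p) :
    HasGradientAt (quadModel f ξ τ x)
      (gradient f x - (1 / τ - 1) • ξ + hess f x (z - x)) z := by
  rw [hasGradientAt_iff_hasFDerivAt]
  have h0 : HasFDerivAt (fun z : Vec p => z - x) (ContinuousLinearMap.id ℝ (Vec p)) z :=
    (hasFDerivAt_id z).sub_const x
  have h1 := (hasFDerivAt_const (gradient f x - (1 / τ - 1) • ξ) z).inner ℝ h0
  have h2 := (((hess f x).hasFDerivAt.comp z h0).inner ℝ h0).const_mul (1 / 2)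
  refine (h1.add h2).congr_fderiv ?_
  ext w
  have := h.hess_comm hx w (z - x)
  simp [inner_sub_left, fderivInnerCLM_apply, real_inner_smul_left] at this ⊢
  linarith

namespace IsCompositeProblem

variable {X : Set (Vec p)} {f : Vec p → ℝ} {g : Vec p → EReal} {x₀ ξ : Vec p} {s : ℝ}

theorem subproblem_eq (P : IsCompositeProblem X f g x₀ ξ s) {τ : ℝ} {x z : Vec p}
    (hz : g z ≠ ⊤) :
    subproblem f g ξ τ x z = ((quadModel f ξ τ x z + 1 / τ * (g z).toReal : ℝ) : EReal) := by
  rw [subproblem, ← P.proper.coe_toReal hz, EReal.coe_add, EReal.coe_mul, EReal.toReal_coe]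
  rfl

theorem ne_top_of_subproblem_ne_top {τ : ℝ} (hτ : 0 < τ) {x z : Vec p}
    (hz : subproblem f g ξ τ x z ≠ ⊤) : g z ≠ ⊤ := by
  intro htop
  rw [subproblem, htop, EReal.coe_mul_top_of_pos (one_div_pos.2 hτ), EReal.coe_add_top] at hz
  exact hz rfl

/-- Optimality condition for the subproblem. -/
theorem subproblem_toReal_le (P : IsCompositeProblem X f g x₀ ξ s) {τ : ℝ} (hτ : 0 < τ)
    {x xbar : Vec p} (hx : x ∈ interior X) (hbar : IsArgmin (subproblem f g ξ τ x) xbar)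
    {y : Vec p} (hy : g y ≠ ⊤) :
    (g xbar).toReal ≤ (g y).toReal +
      τ * inner ℝ (gradient f x - (1 / τ - 1) • ξ + hess f x (xbar - x)) (y - xbar) := by
  have hgb := ne_top_of_subproblem_ne_top hτ hbar.1
  have hd : HasGradientAt (fun z => τ * quadModel f ξ τ x z)
      (τ • (gradient f x - (1 / τ - 1) • ξ + hess f x (xbar - x))) xbar := by
    have := (hasGradientAt_quadModel P.selfConcordant hx ξ τ xbar).hasFDerivAt.const_mul τ
    rw [hasGradientAt_iff_hasFDerivAt]
    refine this.congr_fderiv ?_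
    simp
  have key := P.proper.toReal_le_of_isLocalMin hd hgb (Eventually.of_forall fun z hz => by
    have h1 := hbar.2 z
    rw [P.subproblem_eq hgb, P.subproblem_eq hz, EReal.coe_le_coe_iff] at h1
    have h2 := mul_le_mul_of_nonneg_left h1 hτ.le
    rw [mul_add, mul_add, ← mul_assoc, ← mul_assoc, mul_one_div_cancel hτ.ne', one_mul,
      one_mul] at h2
    exact h2) hy
  rwa [real_inner_smul_left] at key

/-- An inexact step is close, in the local norm at the current iterate, to the target `x*_τ`. -/
theorem localNorm_step_le (P : IsCompositeProblem X f g x₀ ξ s) {τ δ : ℝ} (hτ : 0 < τ)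
    (hδ : 0 ≤ δ) {x x' b : Vec p} (hx : x ∈ interior X)
    (hb : IsArgmin (paramObjective X f g ξ τ) b) (hr : localNorm f x (b - x) < 1)
    (hstep : IsInexactStep f g ξ τ δ x x') :
    localNorm f x (x' - b) ≤ localNorm f x (b - x) ^ 2 / (1 - localNorm f x (b - x)) + δ := by
  have h := P.selfConcordant
  obtain ⟨hbD, hgb, -⟩ := P.isArgmin_iff.1 hb
  obtain ⟨xbar, hbar, hle⟩ := hstep
  have hgbar := ne_top_of_subproblem_ne_top hτ hbar.1
  have hg' : g x' ≠ ⊤ := by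
    refine ne_top_of_subproblem_ne_top (f := f) (ξ := ξ) (x := x) hτ fun htop => ?_
    rw [htop, P.subproblem_eq hgbar, ← EReal.coe_add] at hle
    exact EReal.coe_ne_top _ (top_le_iff.1 hle)
  -- distance of the exact solution to the target
  have d1 : localNorm f x (xbar - b) ≤
      localNorm f x (b - x) ^ 2 / (1 - localNorm f x (b - x)) := by
    have e1 := P.subproblem_toReal_le hτ hx hbar hgb
    have e2 := P.toReal_le hb hgbar
    have e3 := h.inner_gradient_sub_hess_le hx hbD hr (xbar - b)
    have e4 : τ * (1 / τ - 1) = 1 - τ := by field_simp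
    have e5 : hess f x (xbar - x) = hess f x (xbar - b) + hess f x (b - x) := by
      rw [← map_add]
      congr 1
      abel
    rw [← neg_sub xbar b, inner_neg_right, e5] at e1
    simp only [inner_add_left, inner_sub_left, real_inner_smul_left] at e1 e2 e3
    rw [← h.localNorm_sq hx (xbar - b)] at e1
    have e6 : τ * ((1 / τ - 1) * inner ℝ ξ (xbar - b)) = (1 - τ) * inner ℝ ξ (xbar - b) := by
      rw [← mul_assoc, e4]
    set N := localNorm f x (xbar - b)
    have hN : 0 ≤ N := localNorm_nonneg _ _ _
    have e7 := mul_le_mul_of_nonneg_left e3 hτ.le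
    -- Adding the optimality conditions of `xbar` and `b` cancels `g` and `ξ`; what remains is the
    -- linearization error of the gradient between `x` and `b`, tested against `xbar - b`.
    have e8 : τ * (N ^ 2) ≤
        τ * (localNorm f x (b - x) ^ 2 / (1 - localNorm f x (b - x)) * N) := by linarith
    have e9 := le_of_mul_le_mul_left e8 hτ
    rcases hN.eq_or_lt with h0 | h0
    · rw [← h0]
      exact div_nonneg (sq_nonneg _) (sub_nonneg.2 hr.le)
    · rw [sq] at e9
      exact le_of_mul_le_mul_right e9 h0
  -- distance of the inexact to the exact solution
  have d2 : localNorm f x (x' - xbar) ≤ δ := by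
    have e1 := P.subproblem_toReal_le hτ hx hbar hg'
    rw [P.subproblem_eq hgbar, P.subproblem_eq hg', ← EReal.coe_add,
      EReal.coe_le_coe_iff] at hle
    -- The model is quadratic with the Hessian at `x`, so a value gap of `δ² / 2` above the minimum
    -- means local distance at most `δ`.
    have e2 := quadModel_add h hx ξ τ xbar (x' - xbar)
    rw [add_sub_cancel] at e2
    rw [e2] at hle
    refine abs_le_of_sq_le_sq' ?_ hδ |>.2
    set I := inner ℝ (gradient f x - (1 / τ - 1) • ξ + hess f x (xbar - x)) (x' - xbar)
    have e3 := mul_le_mul_of_nonneg_left e1 (one_div_pos.2 hτ).le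
    rw [mul_add, ← mul_assoc, one_div_mul_cancel hτ.ne', one_mul] at e3
    linarith
  have e : x' - b = (xbar - b) + (x' - xbar) := by abel
  rw [e]
  exact (h.localNorm_add_le hx _ _).trans (add_le_add d1 d2)

/-- The same estimate, in the local norm at the target. -/
theorem localNorm_target_step_le (P : IsCompositeProblem X f g x₀ ξ s) {τ δ : ℝ} (hτ : 0 < τ)
    (hδ : 0 ≤ δ) {x x' b : Vec p} (hx : x ∈ interior X)
    (hb : IsArgmin (paramObjective X f g ξ τ) b) (hl : localNorm f b (x - b) < 1 / 2)
    (hstep : IsInexactStep f g ξ τ δ x x') :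
    localNorm f b (x' - b) ≤ localNorm f b (x - b) ^ 2 /
      ((1 - localNorm f b (x - b)) ^ 2 * (1 - 2 * localNorm f b (x - b))) +
        δ / (1 - localNorm f b (x - b)) := by
  have h := P.selfConcordant
  have hbD := (P.isArgmin_iff.1 hb).1
  have hcmp := h.localNorm_le_and_le hbD hx (by linarith)
  set l := localNorm f b (x - b) with hld
  have hl0 : 0 ≤ l := localNorm_nonneg _ _ _
  have h1 : 0 < 1 - l := by linarith
  have h2 : 0 < 1 - 2 * l := by linarith
  have hr : localNorm f x (b - x) ≤ l / (1 - l) := by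
    rw [localNorm_sub_rev]
    exact (hcmp (x - b)).1
  have hl1 : 1 - l / (1 - l) = (1 - 2 * l) / (1 - l) := by
    field_simp
    ring
  have hpos : 0 < 1 - l / (1 - l) := by rw [hl1]; positivity
  have h3 := P.localNorm_step_le hτ hδ hx hb (by linarith) hstep
  have h4 := (hcmp (x' - b)).2
  have h5 : localNorm f x (b - x) ^ 2 / (1 - localNorm f x (b - x)) ≤
      (l / (1 - l)) ^ 2 / (1 - l / (1 - l)) := by
    have := localNorm_nonneg f x (b - x)
    gcongr
  have e : l ^ 2 / ((1 - l) ^ 2 * (1 - 2 * l)) + δ / (1 - l) =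
      ((l / (1 - l)) ^ 2 / (1 - l / (1 - l)) + δ) / (1 - l) := by
    rw [hl1]
    field_simp
  rw [e, le_div_iff₀ h1]
  linarith

end IsCompositeProblem

/-! ### Scalar estimates -/

/-- Here `q = √σ ^ k`, `A = √(σ - 0.01) / 10`, `lk` and `l` are the distances to the old and new
targets, and `r` is the motion of the path. As `0.05 < 1/18`, the sum `lk + r` is at most `A * q`,
which is the purpose of the `1/18` in `Δ`. -/
theorem step_constants {σ q A lk l r δ : ℝ} (hσ : 0.318642 < σ) (hσ' : σ ≤ 1) (hq : 0 ≤ q)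
    (hq' : q ≤ 1) (hA0 : 0 ≤ A) (hA : A ^ 2 = (σ - 0.01) / 100) (hl0 : 0 ≤ l)
    (hlk : lk ≤ 0.05 * q ^ 2) (hr : r ≤ (A - q / 18) * q)
    (hl : l * (1 - r) ≤ lk + r) (hδ' : δ ≤ lk / 113) :
    r < 1 ∧ l < 1 / 2 ∧ l ^ 2 / ((1 - l) ^ 2 * (1 - 2 * l)) + δ / (1 - l) ≤ 0.05 * (σ * q ^ 2) := by
  -- The bound `(A - q / 18) * q` is largest at `q = 9 * A`, with value `4.5 * A ^ 2 < 0.045`.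
  have hr1 : r ≤ 0.045 := by nlinarith [sq_nonneg (A - q / 9)]
  have hAq : 0 ≤ A * q := by positivity
  have h1 : l * 0.955 ≤ A * q := by nlinarith [sq_nonneg q]
  have hA1 : A ≤ 0.1 := by nlinarith
  have hl1 : l ≤ 0.105 := by nlinarith
  refine ⟨by linarith, by linarith, ?_⟩
  have h2 : l ^ 2 * 0.91 ≤ (σ - 0.01) / 100 * q ^ 2 := by
    have := pow_le_pow_left₀ (by positivity) h1 2
    rw [mul_pow, mul_pow, hA] at this
    nlinarith [sq_nonneg l]
  have h3 : 0.63 ≤ (1 - l) ^ 2 * (1 - 2 * l) := by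
    have : 0.8 ≤ (1 - l) ^ 2 := by nlinarith
    nlinarith
  have h4 : l ^ 2 / ((1 - l) ^ 2 * (1 - 2 * l)) ≤ l ^ 2 / 0.63 := by gcongr
  have h5 : δ / (1 - l) ≤ 0.001 * q ^ 2 := by
    rw [div_le_iff₀ (by linarith)]
    nlinarith [sq_nonneg q]
  have h6 : 0.318642 * q ^ 2 ≤ σ * q ^ 2 := mul_le_mul_of_nonneg_right hσ.le (sq_nonneg q)
  have h7 : l ^ 2 / 0.63 = l ^ 2 * 0.91 * (1 / (0.91 * 0.63)) := by ring
  rw [h7] at h4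
  have h8 := mul_le_mul_of_nonneg_right h2 (by norm_num : (0 : ℝ) ≤ 1 / (0.91 * 0.63))
  have h9 : (σ - 0.01) / 100 * q ^ 2 * (1 / (0.91 * 0.63)) ≤ 0.018 * (σ * q ^ 2) := by
    have e : (σ - 0.01) / 100 * q ^ 2 * (1 / (0.91 * 0.63)) =
      (σ * q ^ 2 - 0.01 * q ^ 2) * (1 / (0.91 * 0.63 * 100)) := by ring
    rw [e]
    have : (σ * q ^ 2 - 0.01 * q ^ 2) * (1 / (0.91 * 0.63 * 100)) ≤
        (σ * q ^ 2) * (1 / (0.91 * 0.63 * 100)) :=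
      mul_le_mul_of_nonneg_right (by linarith [sq_nonneg q]) (by norm_num)
    refine this.trans ?_
    rw [mul_comm]
    exact mul_le_mul_of_nonneg_right (by norm_num) (by nlinarith [sq_nonneg q])
  linarith [sq_nonneg q]

theorem C₀_mul_pow_le_Δ {σ : ℝ} (hσ' : σ ≤ 1) (k : ℕ) :
    C₀ σ * √σ ^ k ≤ Δ σ k := by
  have hρ1 : √σ ≤ 1 := Real.sqrt_le_one.2 hσ'
  have hq1 : √σ ^ k ≤ 1 := pow_le_one₀ (Real.sqrt_nonneg _) hρ1
  have hq0 : 0 ≤ √σ ^ k := by positivity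
  unfold Δ
  refine mul_le_mul_of_nonneg_right ?_ hq0
  unfold C₀
  linarith

/-- The homotopy parameter increases and stays in `[τ₀, 1]`. -/
theorem tau_mono {s σ : ℝ} (hs : 0 < s) (hσ : 0 < σ) (hσ' : σ ≤ 1) (hC : 0 < C₀ σ) {τ : ℕ → ℝ}
    (hτ0 : 0 < τ 0) (hτ0' : τ 0 < 1)
    (hτ : ∀ k, τ (k + 1) = min 1 ((1 + Δ σ k / ((1 + Δ σ k) * s)) * τ k)) (k : ℕ) :
    τ 0 ≤ τ k ∧ τ k ≤ 1 ∧ τ k ≤ τ (k + 1) := by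
  have hstep : ∀ k, 0 < τ k → τ k ≤ 1 → τ k ≤ τ (k + 1) := by
    intro k h0 h1
    have hΔ : 0 < Δ σ k := lt_of_lt_of_le (by positivity) (C₀_mul_pow_le_Δ hσ' k)
    rw [hτ k]
    refine le_min h1 (le_mul_of_one_le_left h0.le ?_)
    have : 0 ≤ Δ σ k / ((1 + Δ σ k) * s) := by positivity
    linarith
  have main : ∀ k, τ 0 ≤ τ k ∧ τ k ≤ 1 := by
    intro k
    induction k with
    | zero => exact ⟨le_rfl, hτ0'.le⟩
    | succ k ih =>
      refine ⟨ih.1.trans (hstep k (hτ0.trans_le ih.1) ih.2), ?_⟩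
      rw [hτ k]
      exact min_le_left _ _
  exact ⟨(main k).1, (main k).2, hstep k (hτ0.trans_le (main k).1) (main k).2⟩

/-- Linear convergence of the homotopy parameter. -/
theorem one_sub_tau_le {s σ : ℝ} (hs : 0 < s) (hσ : 0 < σ) (hσ' : σ < 1) {τ : ℕ → ℝ}
    (hτ0 : 0 < τ 0) (hτ0' : τ 0 < 1) (hσc : SigmaCondition s (τ 0) σ)
    (hτ : ∀ k, τ (k + 1) = min 1 ((1 + Δ σ k / ((1 + Δ σ k) * s)) * τ k)) (k : ℕ) :
    1 - τ k ≤ C₀ σ / ((1 + C₀ σ) * s) * τ 0 * √σ ^ k / (1 - √σ) := by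
  obtain ⟨hC, hc⟩ := hσc
  have hρ : 0 < √σ := Real.sqrt_pos.2 hσ
  have hρ1 : √σ < 1 := (Real.sqrt_lt' one_pos).2 (by simpa using hσ')
  have h1ρ : 0 < 1 - √σ := by linarith
  obtain ⟨E, hE⟩ : ∃ E, E = C₀ σ / ((1 + C₀ σ) * s) := ⟨_, rfl⟩
  rw [← hE]
  have hE0 : 0 < E := by rw [hE]; positivity
  rw [le_div_iff₀ h1ρ]
  induction k with
  | zero =>
    rw [pow_zero, mul_one]
    -- For `k = 0` the claim is the condition on `σ`, after taking a square root.
    have h1 : 1 - τ 0 * C₀ σ / ((1 - τ 0) * (1 + C₀ σ) * s) ≤ √σ := Real.le_sqrt_of_sq_le hc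
    have h2 : 0 < 1 - τ 0 := by linarith
    have h3 : τ 0 * C₀ σ / ((1 - τ 0) * (1 + C₀ σ) * s) = E * τ 0 / (1 - τ 0) := by
      rw [hE]
      field_simp
    rw [h3] at h1
    have h4 : 1 - √σ ≤ E * τ 0 / (1 - τ 0) := by linarith
    rw [le_div_iff₀ h2] at h4
    linarith
  | succ k ih =>
    obtain ⟨h0, h1, -⟩ := tau_mono hs hσ hσ'.le hC hτ0 hτ0' hτ k
    have hΔ1 := C₀_mul_pow_le_Δ hσ'.le k
    have hq0 : 0 < √σ ^ k := by positivity
    have hq1 : √σ ^ k ≤ 1 := pow_le_one₀ hρ.le hρ1.le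
    have hΔ : 0 < Δ σ k := lt_of_lt_of_le (by positivity) hΔ1
    -- Since `t / (1 + t)` is increasing, `Δ / (1 + Δ)` is at least `C₀ q / (1 + C₀ q)`, hence at
    -- least `C₀ q / (1 + C₀)` for `q = √σ ^ k ≤ 1`.
    have hε : E * √σ ^ k ≤ Δ σ k / ((1 + Δ σ k) * s) := by
      rw [hE, div_mul_eq_mul_div, div_le_div_iff₀ (by positivity) (by positivity)]
      have : C₀ σ * √σ ^ k * (1 + Δ σ k) ≤ Δ σ k * (1 + C₀ σ) := by
        have := mul_le_mul_of_nonneg_left hq1 (by positivity : 0 ≤ C₀ σ * Δ σ k)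
        linarith
      calc C₀ σ * √σ ^ k * ((1 + Δ σ k) * s) = (C₀ σ * √σ ^ k * (1 + Δ σ k)) * s := by ring
        _ ≤ (Δ σ k * (1 + C₀ σ)) * s := by gcongr
        _ = _ := by ring
    rw [hτ k, pow_succ]
    -- A capped update leaves no gap. Otherwise the gap drops by at least `E * τ 0 * √σ ^ k`, the
    -- first term of the geometric tail that bounds it.
    rcases min_cases (1 : ℝ) ((1 + Δ σ k / ((1 + Δ σ k) * s)) * τ k) with ⟨h, -⟩ | ⟨h, -⟩
    · rw [h, sub_self, zero_mul]
      positivity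
    · rw [h]
      have h2 : E * √σ ^ k * τ 0 ≤ Δ σ k / ((1 + Δ σ k) * s) * τ k := by gcongr
      have h3 := mul_le_mul_of_nonneg_right h2 h1ρ.le
      linarith

/-- Admissible parameters exist for every value of `s ≥ 1`. -/
theorem exists_parameters {s : ℝ} (hs : 1 ≤ s) :
    ∃ t σ : ℝ, 0 < t ∧ t < 1 ∧ 0.318642 < σ ∧ σ < 1 ∧ SigmaCondition s t σ ∧ 0 < Ctilde t σ := by
  -- The value `0.3236 = 0.01 + 0.56 ^ 2` makes the square root rational and lies just above
  -- `0.318642`, near which `C₀` vanishes.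
  have hC : C₀ 0.3236 = 1 / 2250 := by
    have : √(0.3236 - 0.01) = 0.56 := by
      rw [show (0.3236 : ℝ) - 0.01 = 0.56 ^ 2 by norm_num]
      exact Real.sqrt_sq (by norm_num)
    rw [C₀, this]
    norm_num
  -- With `t = K / (1 + K)` one has `t / (1 - t) = K`, chosen so that the squared quantity in
  -- `SigmaCondition` is exactly `0`.
  obtain ⟨K, hK⟩ : ∃ K, K = (1 + 1 / 2250) * s / (1 / 2250 : ℝ) := ⟨_, rfl⟩
  have hK1 : 1 ≤ K := by rw [hK]; linarith
  have ht1 : 1 - K / (1 + K) = 1 / (1 + K) := by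
    field_simp
    ring
  have hsq : √(0.3236 : ℝ) ≤ 0.6 := Real.sqrt_le_iff.2 ⟨by norm_num, by norm_num⟩
  refine ⟨K / (1 + K), 0.3236, by positivity, (div_lt_one (by positivity)).2 (by linarith),
    by norm_num, by norm_num, ⟨by rw [hC]; norm_num, ?_⟩, ?_⟩
  · rw [hC, ht1]
    have : K / (1 + K) * (1 / 2250) / (1 / (1 + K) * (1 + 1 / 2250) * s) = 1 := by
      rw [hK]
      field_simp
    rw [this]
    norm_num
  · rw [Ctilde, hC]
    refine div_pos (by norm_num) ?_
    have h1 : 1 / 2 ≤ K / (1 + K) := by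
      rw [div_le_div_iff₀ two_pos (by positivity)]
      linarith
    have h2 : 0.4 ≤ 1 - √(0.3236 : ℝ) := by linarith
    have h3 : (1 / 2 : ℝ) * (1 + 1 / 2250) * 0.4 ≤
      K / (1 + K) * (1 + 1 / 2250) * (1 - √0.3236) := by gcongr
    linarith

/-! ### Convergence of the scheme -/

namespace IsCompositeProblem

variable {X : Set (Vec p)} {f : Vec p → ℝ} {g : Vec p → EReal} {x₀ ξ : Vec p} {s : ℝ}

theorem isArgmin_paramSol (P : IsCompositeProblem X f g x₀ ξ s) {xs : Vec p}
    (hxs : IsArgmin (paramObjective X f g ξ 1) xs) {τ : ℝ} (hτ : 0 < τ) (hτ1 : τ ≤ 1) :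
    IsArgmin (paramObjective X f g ξ τ) (paramSol X f g ξ τ) :=
  isArgmin_argmin (P.exists_isArgmin hxs hτ hτ1)

/-- One iteration of the scheme contracts the distance to the path by the factor `σ`. -/
theorem localDist_succ_le (P : IsCompositeProblem X f g x₀ ξ s) {xs : Vec p}
    (hxs : IsArgmin (paramObjective X f g ξ 1) xs) {σ : ℝ} (hσ : 0.318642 < σ) (hσ' : σ ≤ 1)
    (hC : 0 < C₀ σ) {k : ℕ} {τ τ' δ : ℝ} (hτ : 0 < τ) (hτ1 : τ ≤ 1) (hττ' : τ ≤ τ')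
    (hτ' : τ' = min 1 ((1 + Δ σ k / ((1 + Δ σ k) * s)) * τ)) {x x' : Vec p}
    (hd : localDist X f g ξ τ x ≤ 0.05 * σ ^ k) (hδ : 0 ≤ δ)
    (hδ' : δ ≤ localDist X f g ξ τ x / 113) (hstep : IsInexactStep f g ξ τ' δ x x') :
    localDist X f g ξ τ' x' ≤ 0.05 * σ ^ (k + 1) := by
  have h := P.selfConcordant
  have hσ0 : 0 < σ := by linarith
  have hτ'0 : 0 < τ' := hτ.trans_le hττ'
  have hτ'1 : τ' ≤ 1 := hτ' ▸ min_le_left _ _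
  have ha := P.isArgmin_paramSol hxs hτ hτ1
  have hb := P.isArgmin_paramSol hxs hτ'0 hτ'1
  rw [localDist] at hd hδ' ⊢
  set a := paramSol X f g ξ τ
  set b := paramSol X f g ξ τ'
  have haD := (P.isArgmin_iff.1 ha).1
  have hbD := (P.isArgmin_iff.1 hb).1
  have hq : σ ^ k = (√σ ^ k) ^ 2 := by
    rw [← pow_mul, mul_comm, pow_mul, Real.sq_sqrt hσ0.le]
  have hq0 : 0 < √σ ^ k := by positivity
  have hq1 : √σ ^ k ≤ 1 := pow_le_one₀ (Real.sqrt_nonneg _) (Real.sqrt_le_one.2 hσ')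
  have hΔ : 0 < Δ σ k := lt_of_lt_of_le (by positivity) (C₀_mul_pow_le_Δ hσ' k)
  have hs := P.pos
  have hr0 : 0 ≤ localNorm f a (b - a) := localNorm_nonneg _ _ _
  -- the path moves by at most `Δ`
  have hr : localNorm f a (b - a) ≤ Δ σ k := by
    have h1 := P.localNorm_sub_le_left hτ hττ' ha hb
    have h2 : τ' ≤ (1 + Δ σ k / ((1 + Δ σ k) * s)) * τ := hτ' ▸ min_le_right _ _
    -- With the update factor inserted, the path bound reads `r / (1 + r) ≤ Δ / (1 + Δ)`, hence `r ≤
    -- Δ`. Capping at `1` only shortens the move.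
    have h3 : (τ' - τ) ≤ Δ σ k / ((1 + Δ σ k) * s) * τ' := by
      have : Δ σ k / ((1 + Δ σ k) * s) * τ ≤ Δ σ k / ((1 + Δ σ k) * s) * τ' := by gcongr
      linarith
    have h4 : τ' * localNorm f a (b - a) ≤
        Δ σ k / ((1 + Δ σ k) * s) * τ' * s * (1 + localNorm f a (b - a)) :=
      h1.trans (by gcongr)
    have h5 : Δ σ k / ((1 + Δ σ k) * s) * τ' * s * (1 + localNorm f a (b - a)) =
        τ' * (Δ σ k * (1 + localNorm f a (b - a)) / (1 + Δ σ k)) := by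
      field_simp
    rw [h5] at h4
    have h6 := le_of_mul_le_mul_left h4 hτ'0
    rw [le_div_iff₀ (by positivity)] at h6
    linarith
  have hxD : x ∈ interior X := by
    have h1 : σ ^ k ≤ 1 := pow_le_one₀ hσ0.le hσ'
    -- Proximal steps are not constrained to `int X`; closeness to the path point `a` puts the
    -- iterate back in the domain.
    have := h.dikin_mem P.tendsto_atTop haD (u := x - a) (by linarith)
    simpa using this
  have hA : (√(σ - 0.01) / 10) ^ 2 = (σ - 0.01) / 100 := by
    rw [div_pow, Real.sq_sqrt (by linarith)]
    norm_num
  rw [hq] at hd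
  have hr' : localNorm f a (b - a) ≤ (√(σ - 0.01) / 10 - √σ ^ k / 18) * √σ ^ k := hr
  have hr1 : localNorm f a (b - a) < 1 := by
    nlinarith [sq_nonneg (√(σ - 0.01) / 10 - √σ ^ k / 9)]
  have hl : localNorm f b (x - b) * (1 - localNorm f a (b - a)) ≤
      localNorm f a (x - a) + localNorm f a (b - a) := by
    have h1 := (h.localNorm_le_and_le haD hbD hr1 (x - b)).1
    rw [le_div_iff₀ (by linarith)] at h1
    have e : x - b = (x - a) + (a - b) := by abel
    have h2 := h.localNorm_add_le haD (x - a) (a - b)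
    rw [← e, localNorm_sub_rev f a a b] at h2
    linarith
  obtain ⟨-, hl2, hfin⟩ := step_constants hσ hσ' hq0.le hq1 (by positivity) hA
    (localNorm_nonneg f b (x - b)) hd hr' hl hδ'
  have := P.localNorm_target_step_le hτ'0 hδ hxD hb hl2 hstep
  rw [pow_succ', hq]
  exact this.trans hfin

/-- Distance of an iterate to the solution, from its distance to the path. -/
theorem localNorm_sub_solution_le (P : IsCompositeProblem X f g x₀ ξ s) {xs : Vec p}
    (hxs : IsArgmin (paramObjective X f g ξ 1) xs) {τ c : ℝ} {a x : Vec p}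
    (ha : IsArgmin (paramObjective X f g ξ τ) a)
    (hc : localNorm f xs (a - xs) ≤ c) (hc1 : c < 1) :
    localNorm f xs (x - xs) ≤ localNorm f a (x - a) / (1 - c) + c := by
  have h := P.selfConcordant
  have hD := (P.isArgmin_iff.1 hxs).1
  have haD := (P.isArgmin_iff.1 ha).1
  have h1 := (h.localNorm_le_and_le hD haD (hc.trans_lt hc1) (x - a)).2
  have h2 := h.localNorm_add_le hD (x - a) (a - xs)
  rw [sub_add_sub_cancel] at h2
  have h3 : localNorm f xs (x - a) ≤ localNorm f a (x - a) / (1 - c) := by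
    rw [le_div_iff₀ (by linarith)]
    have := localNorm_nonneg f xs (x - a)
    nlinarith
  linarith

end IsCompositeProblem

/-- Positivity of `C̃₁` unfolds to positivity of its denominator and forces `σ < 1`. -/
theorem Ctilde_pos {t σ : ℝ} (ht : 0 < t) (hC : 0 < C₀ σ) (h : 0 < Ctilde t σ) :
    0 < t * (1 + C₀ σ) * (1 - √σ) - C₀ σ ∧ σ < 1 := by
  have h1 : 0 < t * (1 + C₀ σ) * (1 - √σ) - C₀ σ := by
    rw [Ctilde] at h
    exact (div_pos_iff_of_pos_left hC).1 h
  refine ⟨h1, ?_⟩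
  by_contra! hge
  have : 1 ≤ √σ := Real.one_le_sqrt.2 hge
  have h2 : t * (1 + C₀ σ) * (1 - √σ) ≤ 0 :=
    mul_nonpos_of_nonneg_of_nonpos (by positivity) (by linarith)
  linarith

/-- A bound of geometric type that holds eventually holds everywhere with a larger constant. -/
theorem exists_forall_le_mul_pow {u : ℕ → ℝ} {ρ c : ℝ} (hρ : 0 < ρ) (hu : ∀ k, 0 ≤ u k)
    (h : ∀ᶠ k in atTop, u k ≤ c * ρ ^ k) : ∃ C, ∀ k, u k ≤ C * ρ ^ k := by
  obtain ⟨N, hN⟩ := eventually_atTop.1 h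
  have hnn : ∀ j, 0 ≤ u j / ρ ^ j := fun j => div_nonneg (hu j) (by positivity)
  refine ⟨|c| + ∑ j ∈ Finset.range N, u j / ρ ^ j, fun k => ?_⟩
  rw [← div_le_iff₀ (by positivity)]
  rcases lt_or_ge k N with hk | hk
  · have := Finset.single_le_sum (f := fun j => u j / ρ ^ j) (fun j _ => hnn j)
      (Finset.mem_range.2 hk)
    have := abs_nonneg c
    linarith
  · have h1 : u k / ρ ^ k ≤ c := (div_le_iff₀ (by positivity)).2 (hN k hk)
    have h2 := Finset.sum_nonneg (s := Finset.range N) (fun j _ => hnn j)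
    have := le_abs_self c
    linarith

end HomotopyPN

end

/-! ### Assembly of the convergence theorem -/

open HomotopyPN in
theorem mainTheorem3 {p : ℕ} (X : Set (Vec p)) (f : Vec p → ℝ) (g : Vec p → EReal) (ν : ℝ)
    -- `f` is a `ν`-self-concordant barrier of `X` with positive definite Hessian
    (hf : IsSelfConcordantBarrier X f ν)
    (hpd : ∀ x ∈ interior X, ∀ u : Vec p, u ≠ 0 → 0 < inner ℝ (hess f x u) u)
    (hg : IsProperClosedConvex g)
    -- `xstar` is an optimal solution of the composite problem
    (xstar : Vec p) (hxstar : IsArgmin (objective X f g) xstar)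
    -- the iterates, with `ξ⁰ ∈ ∂g(x⁰)`
    (x : ℕ → Vec p) (ξ : Vec p) (hx0 : x 0 ∈ interior X) (hξ : IsSubgradient g (x 0) ξ)
    (hcenter : (∃ z, IsAnalyticCenter X f z) ∨ ξ = 0)
    (τ δ : ℕ → ℝ) (hτ0 : 0 < τ 0) (hτ0' : τ 0 < 1)
    (σ : ℝ) (hσ : 0.318642 < σ) (hσ' : σ ≤ 1)
    (hσc : SigmaCondition (√ν + cbar X f ν ξ) (τ 0) σ)
    (hinit : localDist X f g ξ (τ 0) (x 0) ≤ 0.05)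
    -- the parameter update, kept in `(0, 1]`
    (hτ : ∀ k, τ (k + 1) =
      min 1 ((1 + Δ σ k / ((1 + Δ σ k) * (√ν + cbar X f ν ξ))) * τ k))
    (hδ : ∀ k, 0 ≤ δ k) (hδ' : ∀ k, δ k ≤ localDist X f g ξ (τ k) (x k) / 113)
    (hstep : ∀ k, IsInexactStep f g ξ (τ (k + 1)) (δ k) (x k) (x (k + 1))) :
    -- the points `x*_t` are well defined
    (∀ t : ℝ, 0 < t → t ≤ 1 → ∃! z, IsArgmin (paramObjective X f g ξ t) z) ∧
    (∀ k, localDist X f g ξ (τ k) (x k) ≤ 0.05 * σ ^ k) ∧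
    (∀ k, 0 ≤ 1 - τ k) ∧
    (σ < 1 →
      (∀ k, 1 - τ k ≤
        C₀ σ * √σ ^ k / ((1 + C₀ σ) * (√ν + cbar X f ν ξ) * (1 - √σ))) ∧
      Filter.Tendsto (fun k => localDist X f g ξ (τ k) (x k)) Filter.atTop (nhds 0) ∧
      Filter.Tendsto (fun k => 1 - τ k) Filter.atTop (nhds 0)) ∧
    (0 < Ctilde (τ 0) σ →
      (∀ k, Ctilde (τ 0) σ * √σ ^ k < 1 →
        localNorm f xstar (x k - xstar) ≤
          0.05 * σ ^ k / (1 - Ctilde (τ 0) σ * √σ ^ k) + Ctilde (τ 0) σ * √σ ^ k) ∧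
      σ < 1 ∧
      (∃ C : ℝ, ∀ k, localNorm f xstar (x k - xstar) ≤ C * √σ ^ k) ∧
      Filter.Tendsto x Filter.atTop (nhds xstar)) ∧
    -- admissible parameters with `C̃₁ > 0` exist
    (∃ t s : ℝ, 0 < t ∧ t < 1 ∧ 0.318642 < s ∧ s < 1 ∧
      SigmaCondition (√ν + cbar X f ν ξ) t s ∧ 0 < Ctilde t s) := by

  have hν : 0 < ν := zero_lt_one.trans_le hf.one_le
  have hs1 : 1 ≤ √ν + cbar X f ν ξ := by
    have := Real.one_le_sqrt.2 hf.one_le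
    have := cbar_nonneg X f hν.le ξ
    linarith
  have P : IsCompositeProblem X f g (x 0) ξ (√ν + cbar X f ν ξ) :=
    { selfConcordant := hf.isNondegSelfConcordant hpd
      tendsto_atTop := hf.tendsto_atTop
      proper := hg
      mem := hx0
      subgradient := hξ
      pos := by linarith
      inner_le := fun a ha u => inner_add_gradient_le hf hpd hcenter ha u }
  have hxs : IsArgmin (paramObjective X f g ξ 1) xstar := isArgmin_objective_iff.1 hxstar
  generalize √ν + cbar X f ν ξ = s at *
  have hs := P.pos
  have hC := hσc.1
  have hσ0 : 0 < σ := by linarith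
  have hρ : 0 < √σ := Real.sqrt_pos.2 hσ0
  have hmono := tau_mono hs hσ0 hσ' hC hτ0 hτ0' hτ
  have hpos : ∀ k, 0 < τ k := fun k => hτ0.trans_le (hmono k).1
  have hdist : ∀ k, localDist X f g ξ (τ k) (x k) ≤ 0.05 * σ ^ k := by
    intro k
    induction k with
    | zero => simpa using hinit
    | succ k ih =>
      exact P.localDist_succ_le hxs hσ hσ' hC (hpos k) (hmono k).2.1 (hmono k).2.2 (hτ k) ih
        (hδ k) (hδ' k) (hstep k)
  have hrate : σ < 1 → ∀ k, 1 - τ k ≤ C₀ σ * √σ ^ k / ((1 + C₀ σ) * s * (1 - √σ)) := by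
    intro hσ1 k
    have hρ1 : √σ < 1 := (Real.sqrt_lt' one_pos).2 (by simpa using hσ1)
    have h1ρ : 0 < 1 - √σ := by linarith
    refine (one_sub_tau_le hs hσ0 hσ1 hτ0 hτ0' hσc hτ k).trans ?_
    have e : C₀ σ / ((1 + C₀ σ) * s) * τ 0 * √σ ^ k / (1 - √σ) =
        τ 0 * (C₀ σ * √σ ^ k / ((1 + C₀ σ) * s * (1 - √σ))) := by
      field_simp
    rw [e]
    exact mul_le_of_le_one_left (by positivity) hτ0'.le
  refine ⟨?_, hdist, fun k => sub_nonneg.2 (hmono k).2.1, ?_, ?_, exists_parameters hs1⟩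
  · intro t ht ht1
    obtain ⟨a, ha⟩ := P.exists_isArgmin hxs ht ht1
    exact ⟨a, ha, fun b hb => P.isArgmin_unique ht hb ha⟩
  · intro hσ1
    have hρ1 : √σ < 1 := (Real.sqrt_lt' one_pos).2 (by simpa using hσ1)
    refine ⟨hrate hσ1, ?_, ?_⟩
    · refine squeeze_zero (fun k => localNorm_nonneg _ _ _) hdist ?_
      simpa using (tendsto_pow_atTop_nhds_zero_of_lt_one hσ0.le hσ1).const_mul 0.05
    · refine squeeze_zero (fun k => sub_nonneg.2 (hmono k).2.1) (hrate hσ1) ?_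
      simpa using ((tendsto_pow_atTop_nhds_zero_of_lt_one hρ.le hρ1).const_mul
        (C₀ σ)).div_const ((1 + C₀ σ) * s * (1 - √σ))
  · intro hCt
    obtain ⟨hden, hσ1⟩ := Ctilde_pos hτ0 hC hCt
    have hρ1 : √σ < 1 := (Real.sqrt_lt' one_pos).2 (by simpa using hσ1)
    have h1ρ : 0 < 1 - √σ := by linarith
    -- the path approaches the solution at the rate `√σ`
    have hpath : ∀ k, localNorm f xstar (paramSol X f g ξ (τ k) - xstar) ≤
        Ctilde (τ 0) σ * √σ ^ k := by
      intro k
      have ha := P.isArgmin_paramSol hxs (hpos k) (hmono k).2.1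
      have h1 := P.localNorm_sub_le_right (hpos k) (hmono k).2.1 ha hxs
      -- The factor `τ 0`, discarded in the stated rate, is kept here: it cancels against the lower
      -- bound `τ k ≥ τ 0`.
      have h2 := one_sub_tau_le hs hσ0 hσ1 hτ0 hτ0' hσc hτ k
      set r := localNorm f xstar (paramSol X f g ξ (τ k) - xstar)
      have hr0 : 0 ≤ r := localNorm_nonneg _ _ _
      have hq1 : √σ ^ k ≤ 1 := pow_le_one₀ hρ.le hρ1.le
      have hY : 0 < (1 + C₀ σ) * (1 - √σ) := by positivity
      have h3 : (1 - τ k) * s ≤ τ 0 * (C₀ σ * √σ ^ k / ((1 + C₀ σ) * (1 - √σ))) := by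
        refine (mul_le_mul_of_nonneg_right h2 hs.le).trans (le_of_eq ?_)
        field_simp
      have h4 : τ 0 * r ≤ τ 0 * (C₀ σ * √σ ^ k / ((1 + C₀ σ) * (1 - √σ)) * (1 + r)) := by
        have e1 : τ 0 * r ≤ τ k * r := mul_le_mul_of_nonneg_right (hmono k).1 hr0
        have e2 := mul_le_mul_of_nonneg_right h3 (by linarith : 0 ≤ 1 + r)
        linarith
      have h5 := le_of_mul_le_mul_left h4 hτ0
      rw [div_mul_eq_mul_div, le_div_iff₀ hY] at h5
      rw [Ctilde, div_mul_eq_mul_div, le_div_iff₀ hden]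
      -- With `Y = (1 + C₀)(1 - √σ)` and `q = √σ ^ k`, the bound so far is `r (Y - C₀ q) ≤ C₀ q`.
      -- Since `τ 0 ≤ 1` and `q ≤ 1`, `Y - C₀ q` is at least the denominator `τ 0 * Y - C₀` of
      -- `Ctilde`.
      have h6 : τ 0 * ((1 + C₀ σ) * (1 - √σ)) ≤ (1 + C₀ σ) * (1 - √σ) :=
        mul_le_of_le_one_left hY.le hτ0'.le
      have h7 := mul_le_mul_of_nonneg_left h6 hr0
      have h8 := mul_le_mul_of_nonneg_left hq1 (mul_nonneg hC.le hr0)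
      linarith
    have hmain : ∀ k, Ctilde (τ 0) σ * √σ ^ k < 1 → localNorm f xstar (x k - xstar) ≤
        0.05 * σ ^ k / (1 - Ctilde (τ 0) σ * √σ ^ k) + Ctilde (τ 0) σ * √σ ^ k := by
      intro k hk
      have ha := P.isArgmin_paramSol hxs (hpos k) (hmono k).2.1
      refine (P.localNorm_sub_solution_le hxs ha (hpath k) hk).trans ?_
      have h1 : 0 < 1 - Ctilde (τ 0) σ * √σ ^ k := by linarith
      have h2 := div_le_div_of_nonneg_right (hdist k) h1.le
      rw [localDist] at h2
      linarith
    have hpow := tendsto_pow_atTop_nhds_zero_of_lt_one hρ.le hρ1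
    have hbound : ∃ C : ℝ, ∀ k, localNorm f xstar (x k - xstar) ≤ C * √σ ^ k := by
      -- Once `C̃₁ √σ ^ k < 1/2`, the denominator exceeds `1/2`, which doubles `0.05`; and `σ ^ k ≤
      -- √σ ^ k`.
      refine exists_forall_le_mul_pow (c := 0.1 + Ctilde (τ 0) σ) hρ
        (fun k => localNorm_nonneg _ _ _) ?_
      have hsmall : ∀ᶠ k in Filter.atTop, Ctilde (τ 0) σ * √σ ^ k < 1 / 2 := by
        have := hpow.const_mul (Ctilde (τ 0) σ)
        rw [mul_zero] at this
        exact this.eventually (gt_mem_nhds (by norm_num))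
      filter_upwards [hsmall] with k hk
      refine (hmain k (by linarith)).trans ?_
      have h1 : σ ^ k ≤ √σ ^ k := by
        refine pow_le_pow_left₀ hσ0.le ?_ k
        exact Real.le_sqrt_of_sq_le (by nlinarith)
      have h2 : 0.05 * σ ^ k / (1 - Ctilde (τ 0) σ * √σ ^ k) ≤ 0.1 * √σ ^ k := by
        rw [div_le_iff₀ (by linarith)]
        have h3 : 0 < √σ ^ k := by positivity
        nlinarith
      linarith
    refine ⟨hmain, hσ1, hbound, ?_⟩
    obtain ⟨C, hCb⟩ := hbound
    obtain ⟨c, hc, hcn⟩ := P.selfConcordant.exists_mul_norm_le (P.isArgmin_iff.1 hxs).1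
    rw [tendsto_iff_norm_sub_tendsto_zero]
    refine squeeze_zero (fun k => norm_nonneg _) (fun k => ?_)
      (g := fun k => C * √σ ^ k / c) ?_
    · rw [le_div_iff₀' hc]
      exact (hcn _).trans (hCb k)
    · simpa using (hpow.const_mul C).div_const c
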